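/- Let $\mathcal V$ be a combinatorial (that is, locally presentable and cofibrantly generated) symmetric monoidal closed model category, satisfying the pushout-product axiom, in which all objects (in particular the unit $I$) are cofibrant. Let $P\colon\mathcal V\to\operatorname{Ho}\mathcal V$ be the canonical strong monoidal functor to the homotopy category. For a $\mathcal V$-category $\mathcal K$, let $\operatorname{ho}\mathcal K$ be the category with the same objects as $\mathcal K$ and with $\operatorname{ho}\mathcal K(X,Y)=\operatorname{Ho}\mathcal V(PI,P\mathcal K(X,Y))$, and call a morphism $f\colon I\to\mathcal K(X,Y)$ of $\mathcal K$ a homotopy equivalence if its image $P(f)$ in $\operatorname{ho}\mathcal K$ is invertible. Let $\mathcal A$ and $\mathcal B$ be small $\mathcal V$-categories (not assumed to have fibrant hom-objects), and let $V\colon\mathcal A\to\mathcal B$ be a Dwyer--Kan equivalence, that is, a $\mathcal V$-functor such that 1. each $V\colon\mathcal A(A,A')\to\mathcal B(VA,VA')$ is a weak equivalence in $\mathcal V$; and 2. for each object $B\in\mathcal B$ there are an object $A\in\mathcal A$ and a homotopy equivalence $B\to VA$. Then the categories of $\mathcal V$-presheaves $[\mathcal A^{\mathrm{op}},\mathcal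 V]$ and $[\mathcal B^{\mathrm{op}},\mathcal V]$ (with $\mathcal V$-natural transformations as morphisms) admit the projective model structures, in which a morphism is a weak equivalence (respectively a fibration) if and only if each of its components is one in $\mathcal V$. The restriction functor $V^*\colon[\mathcal B^{\mathrm{op}},\mathcal V]\to[\mathcal A^{\mathrm{op}},\mathcal V]$ has a left adjoint $V_!$, and the adjunction $V_!\dashv V^*$ is a Quillen equivalence for the projective model structures: $V_!$ preserves cofibrations and trivial cofibrations, and for every cofibrant $M\in[\mathcal A^{\mathrm{op}},\mathcal V]$ and every fibrant $N\in[\mathcal B^{\mathrm{op}},\mathcal V]$, a morphism $V_!M\to N$ is a weak equivalence if and only if its transpose $M\to V^*N$ is a weak equivalence. -/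

import Mathlib

open CategoryTheory MonoidalCategory Limits Opposite HomotopicalAlgebra
open scoped MonoidalClosed

universe v u u₁ u₂ v₁ v₂

namespace EnrichedDK

noncomputable section

/-! ### The base of enrichment -/

/-- A (symmetric, closed) monoidal model category: the tensor product is a left Quillen bifunctor
(pushout-product axiom) and the unit is cofibrant. -/
class MonoidalModelCategory (V : Type u) [Category.{v} V] [MonoidalCategory V]
    [SymmetricCategory V] [MonoidalClosed V] [ModelCategory V] : Prop where
  cofibration_pushoutProduct {A B X Y : V} (i : A ⟶ B) (j : X ⟶ Y)
    (hi : Cofibration i) (hj : Cofibration j) :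
    Cofibration (Functor.PushoutObjObj.ofHasPushout (curriedTensor V) i j).ι
  weakEquivalence_pushoutProduct_left {A B X Y : V} (i : A ⟶ B) (j : X ⟶ Y)
    (hi : Cofibration i) (hj : Cofibration j) (hi' : WeakEquivalence i) :
    WeakEquivalence (Functor.PushoutObjObj.ofHasPushout (curriedTensor V) i j).ι
  weakEquivalence_pushoutProduct_right {A B X Y : V} (i : A ⟶ B) (j : X ⟶ Y)
    (hi : Cofibration i) (hj : Cofibration j) (hj' : WeakEquivalence j) :
    WeakEquivalence (Functor.PushoutObjObj.ofHasPushout (curriedTensor V) i j).ι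
  isCofibrant_unit : IsCofibrant (𝟙_ V)

/-- A model category is combinatorial if it is locally presentable and cofibrantly generated.
In a locally presentable category every small set of morphisms permits the small object argument,
so that cofibrant generation amounts to the existence of small sets `I` and `J` which detect
trivial fibrations and fibrations. -/
class CombinatorialModelCategory (V : Type u) [Category.{v} V] [ModelCategory V] : Prop where
  isLocallyPresentable : IsLocallyPresentable.{v} V
  exists_generatingCofibrations : ∃ I : MorphismProperty V,
    MorphismProperty.IsSmall.{v} I ∧ I.rlp = trivialFibrations V
  exists_generatingTrivialCofibrations : ∃ J : MorphismProperty V,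
    MorphismProperty.IsSmall.{v} J ∧ J.rlp = fibrations V

section HomotopyCategory

variable (V : Type u) [Category.{v} V] [MonoidalCategory V] [SymmetricCategory V]
  [MonoidalClosed V] [ModelCategory V] [MonoidalModelCategory V] [∀ X : V, IsCofibrant X]

variable {V} in
/-- Tensoring a trivial cofibration with a (cofibrant) object gives a weak equivalence. -/
lemma weakEquivalence_whiskerLeft_of_cofibration (X : V) {Y Z : V} (j : Y ⟶ Z)
    (hj : Cofibration j) (hj' : WeakEquivalence j) : WeakEquivalence (X ◁ j) := by
  have h0 : ∀ T : V, IsInitial ((⊥_ V) ⊗ T) := fun T =>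
    (IsInitial.isInitialObj (tensorLeft T) _ initialIsInitial).ofIso (β_ T (⊥_ V))
  have := MonoidalModelCategory.weakEquivalence_pushoutProduct_right (initial.to X) j
    inferInstance hj hj'
  set sq := Functor.PushoutObjObj.ofHasPushout (curriedTensor V) (initial.to X) j with hsq
  have hiso : IsIso sq.inl := by
    have hI : IsIso (((curriedTensor V).obj (⊥_ V)).map j) :=
      isIso_of_isInitial (h0 Y) (h0 Z) _
    exact sq.isPushout.isIso_inl_of_isIso
  have e : sq.inl ≫ sq.ι = X ◁ j := sq.inl_ι
  rw [← e]
  infer_instance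

/-- When all objects are cofibrant, weak equivalences are stable under tensor products. -/
instance : (weakEquivalences V).IsMonoidal := by
  have hl : ∀ (X : V) {Y Z : V} (g : Y ⟶ Z), WeakEquivalence g → WeakEquivalence (X ◁ g) := by
    intro X Y Z g hg
    obtain ⟨h⟩ := (inferInstance : Nonempty (CofibrantBrownFactorization g))
    have hci : Cofibration h.i := (cofibration_iff _).2 h.hi
    have h1 := weakEquivalence_whiskerLeft_of_cofibration X h.i hci inferInstance
    have h2 := weakEquivalence_whiskerLeft_of_cofibration X h.s inferInstance inferInstance
    have h3 : X ◁ h.s ≫ X ◁ h.p = 𝟙 _ := by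
      rw [← MonoidalCategory.whiskerLeft_comp, h.s_p, MonoidalCategory.whiskerLeft_id]
    have h4 : WeakEquivalence (X ◁ h.p) := weakEquivalence_of_precomp_of_fac h3
    rw [← h.fac, MonoidalCategory.whiskerLeft_comp]
    infer_instance
  refine { whiskerLeft := ?_, whiskerRight := ?_ }
  · intro X Y Z g hg
    rw [← weakEquivalence_iff] at hg ⊢
    exact hl X g hg
  · intro X Y f hf Z
    rw [← weakEquivalence_iff] at hf ⊢
    have := hl Z f hf
    have e : f ▷ Z = (β_ X Z).hom ≫ Z ◁ f ≫ (β_ Y Z).inv := by simp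
    rw [e]
    infer_instance

/-- The homotopy category `Ho V`, with its monoidal structure. -/
abbrev Ho : Type u :=
  LocalizedMonoidal (weakEquivalences V).Q (weakEquivalences V)
    (Iso.refl ((weakEquivalences V).Q.obj (𝟙_ V)))

/-- The canonical strong monoidal functor `P : V ⥤ Ho V`. -/
abbrev toHo : V ⥤ Ho V :=
  Localization.Monoidal.toMonoidalCategory (weakEquivalences V).Q (weakEquivalences V)
    (Iso.refl ((weakEquivalences V).Q.obj (𝟙_ V)))

/-- The homotopy category `ho K` of a `V`-category `K`: the underlying category of the
`Ho V`-category obtained by applying `P` to the hom-objects of `K`. It has the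
same objects as `K`, and the morphisms `X ⟶ Y` are the morphisms from the unit to `P (K(X, Y))`
in `Ho V`. -/
abbrev HoCat (K : Type u₁) [EnrichedCategory V K] : Type u₁ :=
  ForgetEnrichment (Ho V) (TransportEnrichment (toHo V) K)

variable {V} {K : Type u₁} [EnrichedCategory V K]

/-- The morphism of `ho K` induced by a morphism `X ⟶ Y` of `K`, that is, by a morphism
`𝟙_ V ⟶ K(X, Y)` of `V`. -/
def toHoCatMap {X Y : K} (f : 𝟙_ V ⟶ (X ⟶[V] Y)) :
    (ForgetEnrichment.of (Ho V) (C := TransportEnrichment (toHo V) K) X : HoCat V K) ⟶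
      ForgetEnrichment.of (Ho V) (C := TransportEnrichment (toHo V) K) Y :=
  ForgetEnrichment.homOf (Ho V) (C := TransportEnrichment (toHo V) K)
    (Functor.LaxMonoidal.ε (toHo V) ≫ (toHo V).map f)

/-- A morphism of a `V`-category `K` is a homotopy equivalence if it is invertible in `ho K`. -/
def IsHomotopyEquivalence {X Y : K} (f : 𝟙_ V ⟶ (X ⟶[V] Y)) : Prop :=
  IsIso (toHoCatMap f)

/-- A `V`-functor is a Dwyer-Kan equivalence if it is locally a weak equivalence and homotopically
surjective on objects. -/
structure IsDwyerKanEquivalence {L : Type u₂} [EnrichedCategory V L]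
    (W : EnrichedFunctor V K L) : Prop where
  weakEquivalence_map (X Y : K) : WeakEquivalence (W.map X Y)
  exists_homotopyEquivalence (Z : L) :
    ∃ (X : K) (f : 𝟙_ V ⟶ (Z ⟶[V] W.obj X)), IsHomotopyEquivalence f

end HomotopyCategory

/-! ### Enriched presheaves -/

section Presheaves

variable (V : Type u) [Category.{v} V] [MonoidalCategory V] [SymmetricCategory V]
  [MonoidalClosed V]

/-- A presheaf on a `V`-category `A`: a `V`-functor from `Aᵒᵖ` to `V`. -/
structure Presheaf (A : Type u₁) [EnrichedCategory V A] where
  /-- the underlying `V`-functor -/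
  toFunctor : EnrichedFunctor V Aᵒᵖ V

variable {V} {A : Type u₁} [EnrichedCategory V A]

/-- A `V`-natural transformation `F ⟶ G`: a family of morphisms `F a ⟶ G a` such that the two
induced morphisms `Aᵒᵖ(a, b) ⟶ V(F a, G b)` of `V` agree. -/
@[ext]
structure Presheaf.Hom (F G : Presheaf V A) where
  /-- the components -/
  app (a : Aᵒᵖ) : F.toFunctor.obj a ⟶ G.toFunctor.obj a
  naturality (a b : Aᵒᵖ) :
    F.toFunctor.map a b ≫ eHomWhiskerLeft V (F.toFunctor.obj a) (app b) =
      G.toFunctor.map a b ≫ eHomWhiskerRight V (app a) (G.toFunctor.obj b)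

/-- The underlying ordinary category of the presheaf `V`-category `[Aᵒᵖ, V]`. -/
instance : Category (Presheaf V A) where
  Hom F G := Presheaf.Hom F G
  id F := { app := fun a => 𝟙 _, naturality := by simp }
  comp {F G H} σ τ :=
    { app := fun a => σ.app a ≫ τ.app a
      naturality := fun a b => by
        rw [eHomWhiskerLeft_comp, eHomWhiskerRight_comp, reassoc_of% (σ.naturality a b),
          ← reassoc_of% (τ.naturality a b), eHom_whisker_exchange] }

variable {B : Type u₂} [EnrichedCategory V B]

/-- The `V`-functor `Aᵒᵖ ⟶ Bᵒᵖ` induced by a `V`-functor `A ⟶ B`. -/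
def opFunctor (W : EnrichedFunctor V A B) : EnrichedFunctor V Aᵒᵖ Bᵒᵖ where
  obj a := op (W.obj a.unop)
  map a b := W.map b.unop a.unop
  map_id a := W.map_id a.unop
  map_comp a b c := by
    rw [tensorHom_eComp_op_eq, eComp_op_eq, Category.assoc]
    congr 1
    exact W.map_comp _ _ _

/-- Restriction `W^* : [Bᵒᵖ, V] ⥤ [Aᵒᵖ, V]` along a `V`-functor `W : A ⟶ B`. -/
def restriction (W : EnrichedFunctor V A B) : Presheaf V B ⥤ Presheaf V A where
  obj F := ⟨(opFunctor W).comp V F.toFunctor⟩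
  map σ :=
    { app := fun a => σ.app ((opFunctor W).obj a)
      naturality := fun a b => by
        have := σ.naturality ((opFunctor W).obj a) ((opFunctor W).obj b)
        exact (Category.assoc _ _ _).trans
          ((congrArg (fun t => (opFunctor W).map a b ≫ t) this).trans
            (Category.assoc _ _ _).symm) }

/-- A model structure on `[Aᵒᵖ, V]` is projective if its weak equivalences and fibrations are the
morphisms which are componentwise weak equivalences, respectively fibrations, in `V`. -/
structure IsProjective [ModelCategory V] (M : ModelCategory (Presheaf V A)) : Prop where
  weakEquivalence_iff {F G : Presheaf V A} (σ : F ⟶ G) :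
    WeakEquivalence σ ↔ ∀ a : Aᵒᵖ, WeakEquivalence (σ.app a)
  fibration_iff {F G : Presheaf V A} (σ : F ⟶ G) :
    Fibration σ ↔ ∀ a : Aᵒᵖ, Fibration (σ.app a)

end Presheaves

/-! ### Quillen equivalences -/

section Quillen

variable {C : Type u₁} [Category.{v₁} C] [ModelCategory C]
  {D : Type u₂} [Category.{v₂} D] [ModelCategory D] {L : C ⥤ D} {R : D ⥤ C}

/-- An adjunction between model categories is a Quillen adjunction if its left adjoint preserves
cofibrations and trivial cofibrations. -/
structure IsQuillenAdjunction (_adj : L ⊣ R) : Prop where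
  cofibration_map {X Y : C} (f : X ⟶ Y) (hf : Cofibration f) : Cofibration (L.map f)
  weakEquivalence_map {X Y : C} (f : X ⟶ Y) (hf : Cofibration f) (hf' : WeakEquivalence f) :
    WeakEquivalence (L.map f)

/-- A Quillen adjunction `L ⊣ R` is a Quillen equivalence if, for all cofibrant `X` and fibrant `Y`,
a morphism `L X ⟶ Y` is a weak equivalence if and only if its transpose `X ⟶ R Y` is one. -/
structure IsQuillenEquivalence (adj : L ⊣ R) : Prop extends IsQuillenAdjunction adj where
  weakEquivalence_iff_homEquiv {X : C} {Y : D} (hX : IsCofibrant X) (hY : IsFibrant Y)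
    (f : L.obj X ⟶ Y) : WeakEquivalence f ↔ WeakEquivalence (adj.homEquiv X Y f)

end Quillen

end

end EnrichedDK

/-! A presheaf is treated as a family of objects with a unital, associative right action of the
hom-objects. Evaluation at `a` then has a left adjoint `free a`, sending `X` to `X ⊗ Aᵒᵖ(a, -)`, and
a right adjoint `cofree a`, sending `Z` to `[Aᵒᵖ(-, a), Z]`.

Free presheaves on the generators of `V` detect the pointwise (trivial) fibrations, and the small
object argument gives the factorizations. Acyclicity comes from the cofree side: since every object
of `V` is cofibrant, `[X, -]` preserves fibrations and trivial fibrations, so `cofree a` does so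
pointwise. Hence evaluation sends maps lifting against all pointwise fibrations to trivial
cofibrations (`trivialCofibrations_app_of_llp`), and it is left Quillen.

For the equivalence, write `L ⊣ W^*`. The transpose of `L M ⟶ N` is the unit `M ⟶ W^* L M` followed
by `W^*` of the map, so by two-out-of-three two facts suffice.

(i) `W^*` preserves and reflects weak equivalences (`weakEquivalence_restriction_map_iff`). A
presheaf `N` yields a contravariant functor from `ho B` to `Ho V`, so a homotopy equivalence `Z ⟶ W
X` acts by a map `N (W X) ⟶ N Z` invertible in `Ho V`, which is a weak equivalence by saturation.
Naturality carries weak equivalences from the objects `W X` to all `Z`.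

(ii) The unit is a weak equivalence for cofibrant `M` (`weakEquivalence_unit_app`). It is tested at
`a` on homotopy classes of maps into a fibrant `Z`. Maps `M a ⟶ Z` are maps `M ⟶ cofree a Z`; maps
`(L M)(W a) ⟶ Z` are maps `L M ⟶ cofree (W a) Z`, that is, `M ⟶ W^* (cofree (W a) Z)`. The
comparison `W^* (cofree (W a) Z) ⟶ cofree a Z` is, at each object, `[-, Z]` applied to `W` on
hom-objects, hence a weak equivalence (`weakEquivalence_pre_app`). -/

namespace EnrichedDK

noncomputable section

/-! ### Presheaves as objects with an action of the hom-objects. -/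

section Actions

variable {V : Type u} [Category.{v} V] [MonoidalCategory V] [SymmetricCategory V]
  [MonoidalClosed V] {A : Type u₁} [EnrichedCategory V A]

namespace Presheaf

@[ext]
lemma hom_ext {F G : Presheaf V A} {σ τ : F ⟶ G} (h : ∀ a, Hom.app σ a = Hom.app τ a) :
    σ = τ :=
  Hom.ext (funext h)

@[simp]
lemma comp_app {F G H : Presheaf V A} (σ : F ⟶ G) (τ : G ⟶ H) (a : Aᵒᵖ) :
    Hom.app (σ ≫ τ) a = Hom.app σ a ≫ Hom.app τ a := rfl

/-- The right action `F a ⊗ Aᵒᵖ(a, b) ⟶ F b` of the hom-objects on a presheaf. -/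
def act (F : Presheaf V A) (a b : Aᵒᵖ) :
    F.toFunctor.obj a ⊗ (a ⟶[V] b) ⟶ F.toFunctor.obj b :=
  MonoidalClosed.uncurry (F.toFunctor.map a b)

@[simp]
lemma whiskerLeft_eId_act (F : Presheaf V A) (a : Aᵒᵖ) :
    F.toFunctor.obj a ◁ eId V a ≫ F.act a a = (ρ_ _).hom := by
  rw [act, ← MonoidalClosed.uncurry_natural_left, F.toFunctor.map_id]
  exact MonoidalClosed.uncurry_curry _

omit [SymmetricCategory V] in
/-- The transpose of a composition in a closed monoidal category. -/
lemma uncurry_tensorHom_comp {X Y Z S T : V} (f : S ⟶ (ihom X).obj Y) (g : T ⟶ (ihom Y).obj Z) :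
    MonoidalClosed.uncurry ((f ⊗ₘ g) ≫ MonoidalClosed.comp X Y Z) =
      (α_ _ _ _).inv ≫ MonoidalClosed.uncurry f ▷ T ≫ MonoidalClosed.uncurry g := by
  rw [MonoidalClosed.uncurry_natural_left, MonoidalClosed.comp_eq, MonoidalClosed.uncurry_curry,
    MonoidalClosed.compTranspose_eq, MonoidalClosed.uncurry_eq f, MonoidalClosed.uncurry_eq g,
    MonoidalCategory.tensorHom_def]
  simp only [MonoidalCategory.whiskerLeft_comp, comp_whiskerRight, Category.assoc,
    associator_inv_naturality_right_assoc, whisker_exchange_assoc,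
    associator_inv_naturality_middle_assoc]
  rfl

lemma whiskerLeft_eComp_act (F : Presheaf V A) (a b c : Aᵒᵖ) :
    F.toFunctor.obj a ◁ eComp V a b c ≫ F.act a c =
      (α_ _ _ _).inv ≫ F.act a b ▷ _ ≫ F.act b c := by
  rw [act, ← MonoidalClosed.uncurry_natural_left, F.toFunctor.map_comp]
  exact uncurry_tensorHom_comp _ _

/-- Constructor for presheaves, from a unital and associative action. -/
def ofAct (obj : Aᵒᵖ → V) (act : ∀ a b : Aᵒᵖ, obj a ⊗ (a ⟶[V] b) ⟶ obj b)
    (act_id : ∀ a, obj a ◁ eId V a ≫ act a a = (ρ_ _).hom)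
    (act_comp : ∀ a b c, obj a ◁ eComp V a b c ≫ act a c =
      (α_ _ _ _).inv ≫ act a b ▷ _ ≫ act b c) : Presheaf V A where
  toFunctor :=
    { obj := obj
      map := fun a b => MonoidalClosed.curry (act a b)
      map_id := fun a => by
        rw [← MonoidalClosed.curry_natural_left, act_id]
        rfl
      map_comp := fun a b c => by
        rw [← MonoidalClosed.curry_natural_left, act_comp, MonoidalClosed.curry_eq_iff]
        refine Eq.symm ((uncurry_tensorHom_comp _ _).trans ?_)
        simp only [MonoidalClosed.uncurry_curry] }

section

variable (obj : Aᵒᵖ → V) (act : ∀ a b : Aᵒᵖ, obj a ⊗ (a ⟶[V] b) ⟶ obj b)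
  (act_id : ∀ a, obj a ◁ eId V a ≫ act a a = (ρ_ _).hom)
  (act_comp : ∀ a b c, obj a ◁ eComp V a b c ≫ act a c =
    (α_ _ _ _).inv ≫ act a b ▷ _ ≫ act b c)

@[simp]
lemma ofAct_act (a b : Aᵒᵖ) : (ofAct obj act act_id act_comp).act a b = act a b :=
  MonoidalClosed.uncurry_curry _

end

/-- Naturality of a family of morphisms, in terms of the actions. -/
lemma naturality_iff {F G : Presheaf V A}
    (app : ∀ a : Aᵒᵖ, F.toFunctor.obj a ⟶ G.toFunctor.obj a) (a b : Aᵒᵖ) :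
    F.toFunctor.map a b ≫ eHomWhiskerLeft V (F.toFunctor.obj a) (app b) =
      G.toFunctor.map a b ≫ eHomWhiskerRight V (app a) (G.toFunctor.obj b) ↔
    F.act a b ≫ app b = app a ▷ _ ≫ G.act a b := by
  rw [MonoidalClosed.enrichedOrdinaryCategorySelf_eHomWhiskerLeft,
    MonoidalClosed.enrichedOrdinaryCategorySelf_eHomWhiskerRight]
  have h₁ := MonoidalClosed.uncurry_natural_right (A := F.toFunctor.obj a)
    (Y := F.toFunctor.obj b) (F.toFunctor.map a b) (app b)
  have h₂ := MonoidalClosed.uncurry_pre_app (A := G.toFunctor.obj a)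
    (X := G.toFunctor.obj b) (G.toFunctor.map a b) (app a)
  refine (MonoidalClosed.uncurry_injective.eq_iff).symm.trans ?_
  exact Eq.congr h₁ h₂

/-- Constructor for morphisms of presheaves, in terms of the actions. -/
def homMk {F G : Presheaf V A} (app : ∀ a : Aᵒᵖ, F.toFunctor.obj a ⟶ G.toFunctor.obj a)
    (h : ∀ a b, F.act a b ≫ app b = app a ▷ _ ≫ G.act a b) : F ⟶ G :=
  Hom.mk app fun a b => (naturality_iff app a b).2 (h a b)

lemma act_app {F G : Presheaf V A} (σ : F ⟶ G) (a b : Aᵒᵖ) :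
    F.act a b ≫ Hom.app σ b = Hom.app σ a ▷ _ ≫ G.act a b :=
  (naturality_iff (Hom.app σ) a b).1 (Hom.naturality σ a b)

variable (V) in
/-- Evaluation of presheaves at an object. -/
@[simps]
def evaluation (a : Aᵒᵖ) : Presheaf V A ⥤ V where
  obj F := F.toFunctor.obj a
  map σ := Hom.app σ a

end Presheaf

end Actions

/-! ### Pointwise colimits and limits of presheaves. -/

section TensorColimits

variable {V : Type u} [Category.{v} V] [MonoidalCategory V] [SymmetricCategory V]
  [MonoidalClosed V] {J : Type u₂} [Category.{v₂} J]

/-- Preservation of colimits by `- ⊗ X` is what lets a pointwise colimit of presheaves inherit an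
action. -/
instance tensorRight_isLeftAdjoint (X : V) : (tensorRight X).IsLeftAdjoint :=
  Functor.isLeftAdjoint_of_iso (BraidedCategory.tensorLeftIsoTensorRight X)

/-- Tensoring a colimit cocone on the right with an object. -/
def isColimitTensorRight {D : J ⥤ V} {c : Cocone D} (hc : IsColimit c) (X : V) :
    IsColimit ((tensorRight X).mapCocone c) :=
  isColimitOfPreserves (tensorRight X) hc

lemma whiskerRight_hom_ext {D : J ⥤ V} {c : Cocone D} (hc : IsColimit c) {X T : V}
    {f g : c.pt ⊗ X ⟶ T} (h : ∀ j, c.ι.app j ▷ X ≫ f = c.ι.app j ▷ X ≫ g) : f = g :=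
  (isColimitTensorRight hc X).hom_ext h

end TensorColimits

namespace Presheaf

variable {V : Type u} [Category.{v} V] [MonoidalCategory V] [SymmetricCategory V]
  [MonoidalClosed V] {A : Type u₁} [EnrichedCategory V A] {J : Type u₂} [Category.{v₂} J]
  (D : J ⥤ Presheaf V A)

section Colimits

variable (c : ∀ a : Aᵒᵖ, Cocone (D ⋙ evaluation V a)) (hc : ∀ a, IsColimit (c a))

/-- The coprojections of a pointwise colimit. -/
def colimitι (a : Aᵒᵖ) (j : J) : (D.obj j).toFunctor.obj a ⟶ (c a).pt := (c a).ι.app j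

lemma app_colimitι (a : Aᵒᵖ) {j j' : J} (f : j ⟶ j') :
    Hom.app (D.map f) a ≫ colimitι D c a j' = colimitι D c a j :=
  (c a).w f

variable {D c} in
include hc in
lemma colimitι_whiskerRight_hom_ext {a : Aᵒᵖ} {X T : V} {f g : (c a).pt ⊗ X ⟶ T}
    (h : ∀ j, colimitι D c a j ▷ X ≫ f = colimitι D c a j ▷ X ≫ g) : f = g :=
  whiskerRight_hom_ext (hc a) h

/-- The action on a pointwise colimit. -/
def colimitAct (a b : Aᵒᵖ) : (c a).pt ⊗ (a ⟶[V] b) ⟶ (c b).pt :=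
  (isColimitTensorRight (hc a) (a ⟶[V] b)).desc
    (Cocone.mk (c b).pt
      { app := fun j => (D.obj j).act a b ≫ colimitι D c b j
        naturality := fun j j' f => by
          refine Eq.trans ?_ (Category.comp_id _).symm
          refine ((reassoc_of% act_app (D.map f) a b) _).symm.trans ?_
          exact congrArg (_ ≫ ·) (app_colimitι D c b f) })

lemma colimitι_colimitAct (a b : Aᵒᵖ) (j : J) :
    colimitι D c a j ▷ (a ⟶[V] b) ≫ colimitAct D c hc a b =
      (D.obj j).act a b ≫ colimitι D c b j :=
  (isColimitTensorRight (hc a) (a ⟶[V] b)).fac _ j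

/-- The pointwise colimit of a diagram of presheaves. -/
def colimitPresheaf : Presheaf V A :=
  ofAct (fun a => (c a).pt) (colimitAct D c hc)
    (fun a => colimitι_whiskerRight_hom_ext hc fun j => by
      rw [← whisker_exchange_assoc, colimitι_colimitAct, rightUnitor_naturality,
        reassoc_of% @whiskerLeft_eId_act])
    (fun a b d => colimitι_whiskerRight_hom_ext hc fun j => by
      rw [← whisker_exchange_assoc, colimitι_colimitAct, associator_inv_naturality_left_assoc,
        ← comp_whiskerRight_assoc, colimitι_colimitAct, comp_whiskerRight_assoc,
        colimitι_colimitAct, reassoc_of% @whiskerLeft_eComp_act])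

lemma colimitPresheaf_act (a b : Aᵒᵖ) :
    (colimitPresheaf D c hc).act a b = colimitAct D c hc a b :=
  ofAct_act _ _ _ _ _ _

/-- The pointwise colimit cocone of a diagram of presheaves. -/
def colimitCocone : Cocone D where
  pt := colimitPresheaf D c hc
  ι :=
    { app := fun j => homMk (fun a => colimitι D c a j) fun a b => by
        refine (colimitι_colimitAct D c hc a b j).symm.trans ?_
        exact congrArg (_ ≫ ·) (colimitPresheaf_act D c hc a b).symm
      naturality := fun j j' f => by
        ext a
        exact (c a).ι.naturality f }

/-- The components of the morphism from a pointwise colimit to a cocone. -/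
def colimitDesc (s : Cocone D) (a : Aᵒᵖ) : (c a).pt ⟶ s.pt.toFunctor.obj a :=
  (hc a).desc ((evaluation V a).mapCocone s)

lemma colimitι_colimitDesc (s : Cocone D) (a : Aᵒᵖ) (j : J) :
    colimitι D c a j ≫ colimitDesc D c hc s a = Hom.app (s.ι.app j) a :=
  (hc a).fac _ j

lemma colimitAct_colimitDesc (s : Cocone D) (a b : Aᵒᵖ) :
    colimitAct D c hc a b ≫ colimitDesc D c hc s b =
      colimitDesc D c hc s a ▷ _ ≫ s.pt.act a b :=
  colimitι_whiskerRight_hom_ext hc fun j => by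
    rw [reassoc_of% @colimitι_colimitAct, colimitι_colimitDesc, ← comp_whiskerRight_assoc,
      colimitι_colimitDesc]
    exact act_app (s.ι.app j) a b

/-- The pointwise colimit cocone is a colimit. -/
def isColimitColimitCocone : IsColimit (colimitCocone D c hc) where
  desc s := homMk (F := colimitPresheaf D c hc) (colimitDesc D c hc s) fun a b => by
    rw [colimitPresheaf_act]
    exact colimitAct_colimitDesc D c hc s a b
  fac s j := by
    ext a
    exact (hc a).fac ((evaluation V a).mapCocone s) j
  uniq s m hm := by
    ext a
    exact (hc a).uniq ((evaluation V a).mapCocone s) _ fun j =>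
      congrArg (fun t => Hom.app t a) (hm j)

instance hasColimitsOfShape [HasColimitsOfShape J V] : HasColimitsOfShape J (Presheaf V A) where
  has_colimit D :=
    ⟨⟨⟨_, isColimitColimitCocone D (fun a => colimit.cocone (D ⋙ evaluation V a))
      fun _ => colimit.isColimit _⟩⟩⟩

instance preservesColimitsOfShape_evaluation [HasColimitsOfShape J V] (a : Aᵒᵖ) :
    PreservesColimitsOfShape J (evaluation V a) where
  preservesColimit {D} :=
    preservesColimit_of_preserves_colimit_cocone
      (isColimitColimitCocone D (fun a => colimit.cocone (D ⋙ evaluation V a))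
        fun _ => colimit.isColimit _)
      (IsColimit.ofIsoColimit (colimit.isColimit (D ⋙ evaluation V a)) (Iso.refl _))

end Colimits

section Limits

variable (c : ∀ a : Aᵒᵖ, Cone (D ⋙ evaluation V a)) (hc : ∀ a, IsLimit (c a))

/-- The projections of a pointwise limit. -/
def limitπ (a : Aᵒᵖ) (j : J) : (c a).pt ⟶ (D.obj j).toFunctor.obj a := (c a).π.app j

lemma limitπ_app (a : Aᵒᵖ) {j j' : J} (f : j ⟶ j') :
    limitπ D c a j ≫ Hom.app (D.map f) a = limitπ D c a j' :=
  (c a).w f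

variable {D c} in
include hc in
lemma limitπ_hom_ext {a : Aᵒᵖ} {T : V} {f g : T ⟶ (c a).pt}
    (h : ∀ j, f ≫ limitπ D c a j = g ≫ limitπ D c a j) : f = g :=
  (hc a).hom_ext h

/-- The action on a pointwise limit. -/
def limitAct (a b : Aᵒᵖ) : (c a).pt ⊗ (a ⟶[V] b) ⟶ (c b).pt :=
  (hc b).lift
    (Cone.mk ((c a).pt ⊗ (a ⟶[V] b))
      { app := fun j => limitπ D c a j ▷ _ ≫ (D.obj j).act a b
        naturality := fun j j' f => by
          refine (Category.id_comp _).trans (Eq.symm ((Category.assoc _ _ _).trans ?_))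
          refine (congrArg (_ ≫ ·) (act_app (D.map f) a b)).trans ?_
          rw [← comp_whiskerRight_assoc, limitπ_app]
          rfl })

lemma limitAct_limitπ (a b : Aᵒᵖ) (j : J) :
    limitAct D c hc a b ≫ limitπ D c b j = limitπ D c a j ▷ _ ≫ (D.obj j).act a b :=
  (hc b).fac _ j

/-- The pointwise limit of a diagram of presheaves. -/
def limitPresheaf : Presheaf V A :=
  ofAct (fun a => (c a).pt) (limitAct D c hc)
    (fun a => limitπ_hom_ext hc fun j => by
      rw [Category.assoc, limitAct_limitπ, whisker_exchange_assoc, ← rightUnitor_naturality,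
        whiskerLeft_eId_act])
    (fun a b d => limitπ_hom_ext hc fun j => by
      rw [Category.assoc, limitAct_limitπ, whisker_exchange_assoc, Category.assoc,
        Category.assoc, limitAct_limitπ, ← comp_whiskerRight_assoc, limitAct_limitπ,
        comp_whiskerRight_assoc, ← associator_inv_naturality_left_assoc, whiskerLeft_eComp_act])

lemma limitPresheaf_act (a b : Aᵒᵖ) :
    (limitPresheaf D c hc).act a b = limitAct D c hc a b :=
  ofAct_act _ _ _ _ _ _

/-- The pointwise limit cone of a diagram of presheaves. -/
def limitCone : Cone D where
  pt := limitPresheaf D c hc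
  π :=
    { app := fun j => homMk (fun a => limitπ D c a j) fun a b => by
        refine Eq.trans ?_ (limitAct_limitπ D c hc a b j)
        exact congrArg (· ≫ _) (limitPresheaf_act D c hc a b)
      naturality := fun j j' f => by
        ext a
        exact (c a).π.naturality f }

/-- The components of the morphism from a cone to a pointwise limit. -/
def limitLift (s : Cone D) (a : Aᵒᵖ) : s.pt.toFunctor.obj a ⟶ (c a).pt :=
  (hc a).lift ((evaluation V a).mapCone s)

lemma limitLift_limitπ (s : Cone D) (a : Aᵒᵖ) (j : J) :
    limitLift D c hc s a ≫ limitπ D c a j = Hom.app (s.π.app j) a :=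
  (hc a).fac _ j

lemma limitLift_limitAct (s : Cone D) (a b : Aᵒᵖ) :
    s.pt.act a b ≫ limitLift D c hc s b = limitLift D c hc s a ▷ _ ≫ limitAct D c hc a b :=
  limitπ_hom_ext hc fun j => by
    rw [Category.assoc, Category.assoc, limitAct_limitπ, limitLift_limitπ,
      ← comp_whiskerRight_assoc, limitLift_limitπ]
    exact act_app (s.π.app j) a b

/-- The pointwise limit cone is a limit. -/
def isLimitLimitCone : IsLimit (limitCone D c hc) where
  lift s := homMk (G := limitPresheaf D c hc) (limitLift D c hc s) fun a b => by
    rw [limitPresheaf_act]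
    exact limitLift_limitAct D c hc s a b
  fac s j := by
    ext a
    exact (hc a).fac ((evaluation V a).mapCone s) j
  uniq s m hm := by
    ext a
    exact (hc a).uniq ((evaluation V a).mapCone s) _ fun j =>
      congrArg (fun t => Hom.app t a) (hm j)

instance hasLimitsOfShape [HasLimitsOfShape J V] : HasLimitsOfShape J (Presheaf V A) where
  has_limit D :=
    ⟨⟨⟨_, isLimitLimitCone D (fun a => limit.cone (D ⋙ evaluation V a))
      fun _ => limit.isLimit _⟩⟩⟩

end Limits

end Presheaf

/-! ### Internal homs; free and cofree presheaves. -/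

section RightClosed

variable {V : Type u} [Category.{v} V] [MonoidalCategory V] [SymmetricCategory V]
  [MonoidalClosed V]

/-- Evaluation of an internal hom, with the argument on the right. -/
def ihomEv (X Z : V) : (ihom X).obj Z ⊗ X ⟶ Z :=
  (β_ _ _).hom ≫ (ihom.ev X).app Z

/-- Currying of the argument on the right. -/
def curryRight {X Y Z : V} (f : Y ⊗ X ⟶ Z) : Y ⟶ (ihom X).obj Z :=
  MonoidalClosed.curry ((β_ _ _).hom ≫ f)

@[simp]
lemma curryRight_ihomEv {X Y Z : V} (f : Y ⊗ X ⟶ Z) : curryRight f ▷ X ≫ ihomEv X Z = f := by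
  rw [ihomEv, BraidedCategory.braiding_naturality_left_assoc, ← MonoidalClosed.uncurry_eq,
    curryRight, MonoidalClosed.uncurry_curry, SymmetricCategory.symmetry_assoc]

lemma ihomEv_hom_ext {X Y Z : V} {f g : Y ⟶ (ihom X).obj Z}
    (h : f ▷ X ≫ ihomEv X Z = g ▷ X ≫ ihomEv X Z) : f = g := by
  simp only [ihomEv, BraidedCategory.braiding_naturality_left_assoc,
    ← MonoidalClosed.uncurry_eq, cancel_epi] at h
  exact MonoidalClosed.uncurry_injective h

lemma ihomEv_naturality (X : V) {Y Z : V} (f : Y ⟶ Z) :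
    (ihom X).map f ▷ X ≫ ihomEv X Z = ihomEv X Y ≫ f := by
  rw [ihomEv, ihomEv, BraidedCategory.braiding_naturality_left_assoc, ihom.ev_naturality,
    Category.assoc]

lemma curryRight_eq_pre {X Y : V} (f : X ⟶ Y) (Z : V) :
    curryRight ((ihom Y).obj Z ◁ f ≫ ihomEv Y Z) = (MonoidalClosed.pre f).app Z := by
  apply ihomEv_hom_ext
  rw [curryRight_ihomEv]
  simp only [ihomEv, BraidedCategory.braiding_naturality_left_assoc,
    BraidedCategory.braiding_naturality_right_assoc, MonoidalClosed.id_tensor_pre_app_comp_ev]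

end RightClosed

namespace Presheaf

variable {V : Type u} [Category.{v} V] [MonoidalCategory V] [SymmetricCategory V]
  [MonoidalClosed V] {A : Type u₁} [EnrichedCategory V A]

section Free

/-- The free presheaf generated by an object of `V` in degree `a`. -/
def freeObj (a : Aᵒᵖ) (X : V) : Presheaf V A :=
  ofAct (fun c => X ⊗ (a ⟶[V] c)) (fun c d => (α_ _ _ _).hom ≫ X ◁ eComp V a c d)
    (fun c => by
      rw [associator_naturality_right_assoc, ← MonoidalCategory.whiskerLeft_comp,
        (Iso.inv_comp_eq_id _).1 (e_comp_id V a c), whiskerLeft_rightUnitor,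
        Iso.hom_inv_id_assoc])
    (fun b c d => by
      rw [associator_naturality_right_assoc, ← MonoidalCategory.whiskerLeft_comp, ← e_assoc]
      simp only [MonoidalCategory.whiskerLeft_comp, comp_whiskerRight, Category.assoc,
        associator_naturality_middle_assoc, pentagon_inv_hom_hom_hom_inv_assoc])

lemma freeObj_act (a : Aᵒᵖ) (X : V) (c d : Aᵒᵖ) :
    (freeObj a X).act c d = (α_ _ _ _).hom ≫ X ◁ eComp V a c d :=
  ofAct_act _ _ _ _ _ _

/-- The component of a morphism from a free presheaf. -/
def freeDesc {a : Aᵒᵖ} {X : V} {F : Presheaf V A} (g : X ⟶ F.toFunctor.obj a) :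
    freeObj a X ⟶ F :=
  homMk (fun c => g ▷ (a ⟶[V] c) ≫ F.act a c) fun c d => by
    rw [freeObj_act]
    change ((α_ X (a ⟶[V] c) (c ⟶[V] d)).hom ≫ X ◁ eComp V a c d) ≫ g ▷ _ ≫ F.act a d =
      (g ▷ _ ≫ F.act a c) ▷ _ ≫ F.act c d
    rw [Category.assoc, whisker_exchange_assoc, whiskerLeft_eComp_act, comp_whiskerRight_assoc,
      ← associator_naturality_left_assoc, Iso.hom_inv_id_assoc]

/-- The unit of the free adjunction. -/
def freeUnit (a : Aᵒᵖ) (X : V) : X ⟶ (freeObj a X).toFunctor.obj a :=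
  (ρ_ X).inv ≫ X ◁ eId V a

lemma freeUnit_act (a : Aᵒᵖ) (X : V) (c : Aᵒᵖ) :
    freeUnit a X ▷ (a ⟶[V] c) ≫ (freeObj a X).act a c = 𝟙 (X ⊗ (a ⟶[V] c)) := by
  rw [freeObj_act]
  change ((ρ_ X).inv ≫ X ◁ eId V a) ▷ (a ⟶[V] c) ≫ (α_ _ _ _).hom ≫ X ◁ eComp V a a c = _
  rw [comp_whiskerRight_assoc, associator_naturality_middle_assoc,
    ← MonoidalCategory.whiskerLeft_comp, (Iso.inv_comp_eq_id _).1 (e_id_comp V a c)]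
  simp

/-- The universal property of the free presheaf. -/
def freeHomEquiv (a : Aᵒᵖ) (X : V) (F : Presheaf V A) :
    (freeObj a X ⟶ F) ≃ (X ⟶ F.toFunctor.obj a) where
  toFun σ := freeUnit a X ≫ Hom.app σ a
  invFun g := freeDesc g
  left_inv σ := by
    ext c
    change (freeUnit a X ≫ Hom.app σ a) ▷ (a ⟶[V] c) ≫ F.act a c = _
    rw [comp_whiskerRight_assoc, ← act_app]
    exact ((reassoc_of% freeUnit_act a X c) _).trans (Category.id_comp _)
  right_inv g := by
    change ((ρ_ X).inv ≫ X ◁ eId V a) ≫ g ▷ (a ⟶[V] a) ≫ F.act a a = g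
    rw [Category.assoc, whisker_exchange_assoc, whiskerLeft_eId_act]
    simp

/-- The free presheaf functor, left adjoint to evaluation at `a`. -/
def free (a : Aᵒᵖ) : V ⥤ Presheaf V A :=
  Adjunction.leftAdjointOfEquiv (G := evaluation V a) (freeHomEquiv a)
    fun _ _ _ _ _ => (Category.assoc _ _ _).symm

/-- The free presheaf functor is left adjoint to evaluation. -/
def freeAdjunction (a : Aᵒᵖ) : free a ⊣ evaluation V (A := A) a :=
  Adjunction.adjunctionOfEquivLeft (G := evaluation V a) (freeHomEquiv a)
    fun _ _ _ _ _ => (Category.assoc _ _ _).symm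

end Free

section Cofree

/-- The action on a cofree presheaf. -/
def cofreeAct (a : Aᵒᵖ) (Z : V) (c d : Aᵒᵖ) :
    (ihom (c ⟶[V] a)).obj Z ⊗ (c ⟶[V] d) ⟶ (ihom (d ⟶[V] a)).obj Z :=
  curryRight ((α_ _ _ _).hom ≫ _ ◁ eComp V c d a ≫ ihomEv _ Z)

lemma cofreeAct_ihomEv (a : Aᵒᵖ) (Z : V) (c d : Aᵒᵖ) :
    cofreeAct a Z c d ▷ _ ≫ ihomEv (d ⟶[V] a) Z =
      (α_ _ _ _).hom ≫ _ ◁ eComp V c d a ≫ ihomEv _ Z :=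
  curryRight_ihomEv _

/-- The cofree presheaf generated by an object of `V` in degree `a`. -/
def cofreeObj (a : Aᵒᵖ) (Z : V) : Presheaf V A :=
  ofAct (fun c => (ihom (c ⟶[V] a)).obj Z) (cofreeAct a Z)
    (fun c => ihomEv_hom_ext <| by
      rw [comp_whiskerRight_assoc, cofreeAct_ihomEv, associator_naturality_middle_assoc,
        ← MonoidalCategory.whiskerLeft_comp_assoc, (Iso.inv_comp_eq_id _).1 (e_id_comp V c a)]
      simp)
    (fun b c d => ihomEv_hom_ext <| by
      rw [comp_whiskerRight_assoc, cofreeAct_ihomEv, associator_naturality_middle_assoc,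
        ← MonoidalCategory.whiskerLeft_comp_assoc, ← e_assoc',
        comp_whiskerRight_assoc, comp_whiskerRight_assoc, cofreeAct_ihomEv,
        associator_naturality_left_assoc, ← whisker_exchange_assoc, cofreeAct_ihomEv]
      simp)

lemma cofreeObj_act (a : Aᵒᵖ) (Z : V) (c d : Aᵒᵖ) :
    (cofreeObj a Z).act c d = cofreeAct a Z c d :=
  ofAct_act _ _ _ _ _ _

lemma curryRight_act_comp_cofreeAct {F : Presheaf V A} {a : Aᵒᵖ} {Z : V}
    (g : F.toFunctor.obj a ⟶ Z) (c d : Aᵒᵖ) :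
    F.act c d ≫ curryRight (F.act d a ≫ g) =
      curryRight (F.act c a ≫ g) ▷ (c ⟶[V] d) ≫ cofreeAct a Z c d :=
  ihomEv_hom_ext <| by
    rw [comp_whiskerRight_assoc, comp_whiskerRight_assoc, cofreeAct_ihomEv, curryRight_ihomEv,
      associator_naturality_left_assoc, ← whisker_exchange_assoc, curryRight_ihomEv,
      reassoc_of% @whiskerLeft_eComp_act, Iso.hom_inv_id_assoc]

/-- The morphism to a cofree presheaf. -/
def cofreeLift {F : Presheaf V A} {a : Aᵒᵖ} {Z : V} (g : F.toFunctor.obj a ⟶ Z) :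
    F ⟶ cofreeObj a Z :=
  homMk (fun c => curryRight (F.act c a ≫ g)) fun c d => by
    rw [cofreeObj_act]
    exact curryRight_act_comp_cofreeAct g c d

/-- The counit of the cofree adjunction. -/
def cofreeCounit (a : Aᵒᵖ) (Z : V) : (ihom (a ⟶[V] a)).obj Z ⟶ Z :=
  (ρ_ _).inv ≫ _ ◁ eId V a ≫ ihomEv _ Z

/-- The counit evaluates at the identity of `a`; acting first by `c ⟶ a` and then evaluating at the
identity is evaluating at `c ⟶ a`, by the unit law of composition. -/
lemma cofreeAct_cofreeCounit (a : Aᵒᵖ) (Z : V) (c : Aᵒᵖ) :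
    cofreeAct a Z c a ≫ cofreeCounit a Z = ihomEv _ Z := by
  rw [cofreeCounit, rightUnitor_inv_naturality_assoc, ← whisker_exchange_assoc,
    cofreeAct_ihomEv, associator_naturality_right_assoc,
    ← MonoidalCategory.whiskerLeft_comp_assoc, (Iso.inv_comp_eq_id _).1 (e_comp_id V c a)]
  simp

/-- The universal property of the cofree presheaf. -/
def cofreeHomEquiv (a : Aᵒᵖ) (F : Presheaf V A) (Z : V) :
    (F.toFunctor.obj a ⟶ Z) ≃ (F ⟶ cofreeObj a Z) where
  toFun g := cofreeLift g
  invFun σ := Hom.app σ a ≫ cofreeCounit a Z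
  left_inv g := by
    change curryRight (F.act a a ≫ g) ≫ cofreeCounit a Z = g
    rw [cofreeCounit, rightUnitor_inv_naturality_assoc, ← whisker_exchange_assoc,
      curryRight_ihomEv, reassoc_of% @whiskerLeft_eId_act, Iso.inv_hom_id_assoc]
  right_inv σ := by
    ext c
    apply ihomEv_hom_ext
    change curryRight (F.act c a ≫ Hom.app σ a ≫ cofreeCounit a Z) ▷ _ ≫ ihomEv _ Z = _
    rw [curryRight_ihomEv]
    refine ((reassoc_of% act_app σ c a) _).trans ?_
    rw [cofreeObj_act]
    exact congrArg (_ ≫ ·) (cofreeAct_cofreeCounit a Z c)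

lemma cofreeHomEquiv_naturality (a : Aᵒᵖ) {F G : Presheaf V A} {Z : V} (σ : F ⟶ G)
    (g : G.toFunctor.obj a ⟶ Z) :
    cofreeHomEquiv a F Z (Hom.app σ a ≫ g) = σ ≫ cofreeHomEquiv a G Z g := by
  ext c
  apply ihomEv_hom_ext
  change curryRight (F.act c a ≫ Hom.app σ a ≫ g) ▷ _ ≫ ihomEv _ Z =
    (Hom.app σ c ≫ curryRight (G.act c a ≫ g)) ▷ _ ≫ ihomEv _ Z
  rw [curryRight_ihomEv, comp_whiskerRight_assoc, curryRight_ihomEv, reassoc_of% @act_app]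

/-- The cofree presheaf functor, right adjoint to evaluation at `a`. -/
def cofree (a : Aᵒᵖ) : V ⥤ Presheaf V A :=
  Adjunction.rightAdjointOfEquiv (F := evaluation V a) (cofreeHomEquiv a)
    fun _ _ _ f g => cofreeHomEquiv_naturality a f g

/-- The cofree presheaf functor is right adjoint to evaluation. -/
def cofreeAdjunction (a : Aᵒᵖ) : evaluation V (A := A) a ⊣ cofree a :=
  Adjunction.adjunctionOfEquivRight (F := evaluation V a) (cofreeHomEquiv a)
    fun _ _ _ f g => cofreeHomEquiv_naturality a f g

lemma cofreeAdjunction_homEquiv (a : Aᵒᵖ) (F : Presheaf V A) (Z : V) :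
    (cofreeAdjunction a).homEquiv F Z = cofreeHomEquiv a F Z :=
  congrFun (congrFun (Adjunction.mkOfHomEquiv_homEquiv (F := evaluation V a) (G := cofree a) _) F) Z

/-- Functoriality of `cofree a` is defined by transposition; this identification reduces its
homotopical properties to those of internal homs in `V`. -/
lemma cofree_map_app (a : Aᵒᵖ) {Y Z : V} (f : Y ⟶ Z) (c : Aᵒᵖ) :
    Hom.app ((cofree a).map f) c = (ihom (c ⟶[V] a)).map f := by
  apply ihomEv_hom_ext
  change curryRight ((cofreeObj a Y).act c a ≫
    (𝟙 ((ihom (a ⟶[V] a)).obj Y) ≫ cofreeCounit a Y) ≫ f) ▷ _ ≫ ihomEv _ Z = _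
  rw [curryRight_ihomEv, cofreeObj_act]
  change cofreeAct a Y c a ≫ (𝟙 ((ihom (a ⟶[V] a)).obj Y) ≫ cofreeCounit a Y) ≫ f = _
  rw [Category.id_comp, reassoc_of% @cofreeAct_cofreeCounit]
  exact (ihomEv_naturality _ f).symm

end Cofree

end Presheaf

/-! ### Smallness, and internal homs against fibrations. -/

section SmallObject

/-- A `v`-small family of cardinals is bounded by one regular cardinal, and presentability persists
to larger regular cardinals. -/
lemma exists_isCardinalPresentable {C : Type u₁} [Category.{v} C] {ι : Type v} (X : ι → C)
    [∀ i, IsPresentable.{v} (X i)] :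
    ∃ (κ : Cardinal.{v}) (_ : Fact κ.IsRegular), ∀ i, IsCardinalPresentable (X i) κ := by
  have h (i : ι) := (inferInstance : IsPresentable.{v} (X i)).exists_cardinal
  choose k hk hX using h
  obtain ⟨κ, hκ, h⟩ := HasCardinalLT.exists_regular_cardinal_forall.{v} fun i => (k i).out
  have : Fact κ.IsRegular := ⟨hκ⟩
  refine ⟨κ, this, fun i => ?_⟩
  have hle : k i ≤ κ := by simpa [hasCardinalLT_iff_cardinal_mk_lt] using (h i).le
  exact isCardinalPresentable_of_le (X i) hle

lemma hasSmallObjectArgument_ofHoms {C : Type u₁} [Category.{v} C] [HasColimitsOfSize.{v, v} C]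
    {ι : Type v} {S T : ι → C} (f : ∀ i, S i ⟶ T i) [∀ i, IsPresentable.{v} (S i)] :
    MorphismProperty.HasSmallObjectArgument.{v} (MorphismProperty.ofHoms f) := by
  obtain ⟨κ, hκ, h⟩ := exists_isCardinalPresentable S
  have : Nonempty κ.ord.ToType := by simpa using hκ.out.ne_zero
  have := WellFoundedLT.toOrderBot κ.ord.ToType
  exact ⟨κ, hκ, this,
    { preservesColimit := fun i hi g hg => by
        obtain ⟨j⟩ := hi
        have := preservesColimitsOfShape_of_isCardinalPresentable (S j) κ κ.ord.ToType
        infer_instance }⟩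

end SmallObject

section MonoidalModel

variable {V : Type u} [Category.{v} V] [MonoidalCategory V] [SymmetricCategory V]
  [MonoidalClosed V] [ModelCategory V] [MonoidalModelCategory V] [∀ X : V, IsCofibrant X]

/-- Tensoring with a (cofibrant) object preserves cofibrations. -/
lemma cofibration_whiskerLeft (X : V) {Y Z : V} (j : Y ⟶ Z) (hj : Cofibration j) :
    Cofibration (X ◁ j) := by
  have h0 : ∀ T : V, IsInitial ((⊥_ V) ⊗ T) := fun T =>
    (IsInitial.isInitialObj (tensorLeft T) _ initialIsInitial).ofIso (β_ T (⊥_ V))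
  have := MonoidalModelCategory.cofibration_pushoutProduct (initial.to X) j inferInstance hj
  set sq := Functor.PushoutObjObj.ofHasPushout (curriedTensor V) (initial.to X) j
  have hiso : IsIso sq.inl := by
    have hI : IsIso (((curriedTensor V).obj (⊥_ V)).map j) :=
      isIso_of_isInitial (h0 Y) (h0 Z) _
    exact sq.isPushout.isIso_inl_of_isIso
  have e : sq.inl ≫ sq.ι = X ◁ j := sq.inl_ι
  rw [← e]
  infer_instance

/-- By adjunction, lifting `i` against `[X, p]` is lifting `X ⊗ i` against `p`, and tensoring with
the cofibrant object `X` keeps `i` a trivial cofibration. -/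
lemma fibration_ihom_map (X : V) {Y Z : V} (p : Y ⟶ Z) (hp : Fibration p) :
    Fibration ((ihom X).map p) := by
  rw [fibration_iff, ← MorphismProperty.rlp_eq_of_wfs (trivialCofibrations V) (fibrations V)]
  intro S T i hi
  rw [mem_trivialCofibrations_iff] at hi
  rw [← (ihom.adjunction X).hasLiftingProperty_iff]
  have h₁ : Cofibration ((tensorLeft X).map i) := cofibration_whiskerLeft X i hi.1
  have h₂ : WeakEquivalence ((tensorLeft X).map i) :=
    weakEquivalence_whiskerLeft_of_cofibration X i hi.1 hi.2
  infer_instance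

lemma trivialFibration_ihom_map (X : V) {Y Z : V} (p : Y ⟶ Z) (hp : trivialFibrations V p) :
    trivialFibrations V ((ihom X).map p) := by
  rw [mem_trivialFibrations_iff] at hp
  obtain ⟨_, _⟩ := hp
  rw [← MorphismProperty.rlp_eq_of_wfs (cofibrations V) (trivialFibrations V)]
  intro S T i hi
  rw [← cofibration_iff] at hi
  rw [← (ihom.adjunction X).hasLiftingProperty_iff]
  have h₁ : Cofibration ((tensorLeft X).map i) := cofibration_whiskerLeft X i hi
  infer_instance

end MonoidalModel

/-! ### The projective model structure. -/

namespace Presheaf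

variable {V : Type u} [Category.{v} V] [MonoidalCategory V] [SymmetricCategory V]
  [MonoidalClosed V]

section

variable {A : Type u₁} [EnrichedCategory V A]

/-- The free presheaf morphisms on a family of morphisms of `V`. -/
def freeMaps {ι : Type v} {X Y : ι → V} (f : ∀ i, X i ⟶ Y i) :
    MorphismProperty (Presheaf V A) :=
  MorphismProperty.ofHoms fun x : Aᵒᵖ × ι => (free (A := A) x.1).map (f x.2)

lemma freeMaps_rlp_iff {ι : Type v} {X Y : ι → V} (f : ∀ i, X i ⟶ Y i) {F G : Presheaf V A}
    (σ : F ⟶ G) :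
    (freeMaps f).rlp σ ↔ ∀ a, (MorphismProperty.ofHoms f).rlp (Hom.app σ a) := by
  constructor
  · rintro h a _ _ _ ⟨i⟩
    exact ((freeAdjunction a).hasLiftingProperty_iff (f i) σ).1 (h _ ⟨(a, i)⟩)
  · rintro h _ _ _ ⟨a, i⟩
    exact ((freeAdjunction a).hasLiftingProperty_iff (f i) σ).2 (h a _ ⟨i⟩)

end

variable [ModelCategory V]

section

variable {A : Type u₁} [EnrichedCategory V A]

variable (V A) in
/-- Componentwise weak equivalences of presheaves. -/
def pointwiseWeakEquivalences : MorphismProperty (Presheaf V A) :=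
  fun _ _ σ => ∀ a, WeakEquivalence (Hom.app σ a)

variable (V A) in
/-- Componentwise fibrations of presheaves. -/
def pointwiseFibrations : MorphismProperty (Presheaf V A) :=
  fun _ _ σ => ∀ a, Fibration (Hom.app σ a)

instance : (pointwiseWeakEquivalences V A).HasTwoOutOfThreeProperty where
  comp_mem f g hf hg a := by
    have := hf a
    have := hg a
    rw [comp_app]
    infer_instance
  of_postcomp f g hg hfg a := by
    have := hg a
    have := hfg a
    rw [comp_app] at this
    exact weakEquivalence_of_postcomp (Hom.app f a) (Hom.app g a)
  of_precomp f g hf hfg a := by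
    have := hf a
    have := hfg a
    rw [comp_app] at this
    exact weakEquivalence_of_precomp (Hom.app f a) (Hom.app g a)

end

section

variable {A : Type v} [EnrichedCategory V A] [IsLocallyPresentable.{v} V]

instance hasColimitsOfSize_of_isLocallyPresentable : HasColimitsOfSize.{v, v} V := by
  obtain ⟨κ, _, _⟩ := IsLocallyPresentable.exists_cardinal.{v} V
  infer_instance

instance : HasColimitsOfSize.{v, v} (Presheaf V A) where
  has_colimits_of_shape _ := inferInstance

/-- Evaluation preserves colimits, so its left adjoint preserves presentable objects. -/
instance isPresentable_free (a : Aᵒᵖ) (X : V) : IsPresentable.{v} ((free (A := A) a).obj X) := by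
  obtain ⟨κ, _, _⟩ := (inferInstance : IsPresentable.{v} X).exists_cardinal
  have : (evaluation V a).IsCardinalAccessible κ := ⟨fun _ _ _ => inferInstance⟩
  have := (freeAdjunction a).isCardinalPresentable_leftAdjoint_obj κ X
  exact isPresentable_of_isCardinalPresentable _ κ

instance hasSmallObjectArgument_freeMaps {ι : Type v} {X Y : ι → V} (f : ∀ i, X i ⟶ Y i) :
    MorphismProperty.HasSmallObjectArgument.{v} (freeMaps (A := A) f) := by
  have := hasSmallObjectArgument_ofHoms (C := Presheaf V A)
    (ι := Aᵒᵖ × ι) fun x => (free (A := A) x.1).map (f x.2)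
  exact this

end

section

variable {A : Type u₁} [EnrichedCategory V A] [MonoidalModelCategory V] [∀ X : V, IsCofibrant X]

/-- Lifting `σ.app a` against `p` is lifting `σ` against `cofree a` of `p`, a pointwise fibration.
This replaces an analysis of the cell complexes built from free maps. -/
lemma trivialCofibrations_app_of_llp {F G : Presheaf V A} (σ : F ⟶ G)
    (h : (pointwiseFibrations V A).llp σ) (a : Aᵒᵖ) :
    trivialCofibrations V (Hom.app σ a) := by
  rw [← MorphismProperty.llp_eq_of_wfs (trivialCofibrations V) (fibrations V)]
  intro X Y p hp
  refine ((cofreeAdjunction a).hasLiftingProperty_iff σ p).2 (h _ fun c => ?_)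
  rw [cofree_map_app]
  exact fibration_ihom_map _ p ((fibration_iff p).2 hp)

lemma cofibration_app_of_llp {F G : Presheaf V A} (σ : F ⟶ G)
    (h : (pointwiseFibrations V A ⊓ pointwiseWeakEquivalences V A).llp σ) (a : Aᵒᵖ) :
    Cofibration (Hom.app σ a) := by
  rw [cofibration_iff, ← MorphismProperty.llp_eq_of_wfs (cofibrations V) (trivialFibrations V)]
  intro X Y p hp
  have hc (c : Aᵒᵖ) : trivialFibrations V (Hom.app ((cofree a).map p) c) := by
    rw [cofree_map_app]
    exact trivialFibration_ihom_map _ p hp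
  exact ((cofreeAdjunction a).hasLiftingProperty_iff σ p).2
    (h _ ⟨fun c => ((mem_trivialFibrations_iff _).1 (hc c)).1,
      fun c => ((mem_trivialFibrations_iff _).1 (hc c)).2⟩)

end

section

variable {A : Type v} [EnrichedCategory V A] [CombinatorialModelCategory V]

lemma exists_freeMaps_rlp_eq_fibrations : ∃ (ι : Type v) (X Y : ι → V) (f : ∀ i, X i ⟶ Y i),
    (freeMaps (A := A) f).rlp = pointwiseFibrations V A := by
  obtain ⟨J, hJ, h⟩ := CombinatorialModelCategory.exists_generatingTrivialCofibrations (V := V)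
  obtain ⟨ι, X, Y, f, rfl⟩ := (MorphismProperty.isSmall_iff_eq_ofHoms J).1 hJ
  refine ⟨ι, X, Y, f, ?_⟩
  ext F G σ
  simp only [freeMaps_rlp_iff, h, pointwiseFibrations, fibration_iff]

lemma exists_freeMaps_rlp_eq_trivialFibrations :
    ∃ (ι : Type v) (X Y : ι → V) (f : ∀ i, X i ⟶ Y i),
      (freeMaps (A := A) f).rlp = pointwiseFibrations V A ⊓ pointwiseWeakEquivalences V A := by
  obtain ⟨I, hI, h⟩ := CombinatorialModelCategory.exists_generatingCofibrations (V := V)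
  obtain ⟨ι, X, Y, f, rfl⟩ := (MorphismProperty.isSmall_iff_eq_ofHoms I).1 hI
  refine ⟨ι, X, Y, f, ?_⟩
  ext F G σ
  simp only [freeMaps_rlp_iff, h, mem_trivialFibrations_iff]
  exact forall_and

instance hasFactorization_fibrations : MorphismProperty.HasFactorization
    (pointwiseFibrations V A).llp (pointwiseFibrations V A) := by
  have := CombinatorialModelCategory.isLocallyPresentable (V := V)
  obtain ⟨ι, X, Y, f, h⟩ := exists_freeMaps_rlp_eq_fibrations (V := V) (A := A)
  have := MorphismProperty.instHasFunctorialFactorizationLlpRlp.{v} (freeMaps (A := A) f)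
  rw [← h]
  infer_instance

instance hasFactorization_trivialFibrations : MorphismProperty.HasFactorization
    (pointwiseFibrations V A ⊓ pointwiseWeakEquivalences V A).llp
    (pointwiseFibrations V A ⊓ pointwiseWeakEquivalences V A) := by
  have := CombinatorialModelCategory.isLocallyPresentable (V := V)
  obtain ⟨ι, X, Y, f, h⟩ := exists_freeMaps_rlp_eq_trivialFibrations (V := V) (A := A)
  have := MorphismProperty.instHasFunctorialFactorizationLlpRlp.{v} (freeMaps (A := A) f)
  rw [← h]
  infer_instance

lemma llp_rlp_trivialFibrations :
    (pointwiseFibrations V A ⊓ pointwiseWeakEquivalences V A).llp.rlp =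
      pointwiseFibrations V A ⊓ pointwiseWeakEquivalences V A := by
  obtain ⟨ι, X, Y, f, h⟩ := exists_freeMaps_rlp_eq_trivialFibrations (V := V) (A := A)
  rw [← h, MorphismProperty.rlp_llp_rlp]

lemma llp_rlp_fibrations : (pointwiseFibrations V A).llp.rlp = pointwiseFibrations V A := by
  obtain ⟨ι, X, Y, f, h⟩ := exists_freeMaps_rlp_eq_fibrations (V := V) (A := A)
  rw [← h, MorphismProperty.rlp_llp_rlp]

variable [MonoidalModelCategory V] [∀ X : V, IsCofibrant X]

lemma llp_inf_weakEquivalences :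
    (pointwiseFibrations V A ⊓ pointwiseWeakEquivalences V A).llp ⊓
      pointwiseWeakEquivalences V A = (pointwiseFibrations V A).llp := by
  apply le_antisymm
  · rintro F G σ ⟨h₁, h₂⟩
    have d := MorphismProperty.factorizationData (pointwiseFibrations V A).llp
      (pointwiseFibrations V A) σ
    have hi : pointwiseWeakEquivalences V A d.i := fun a =>
      ((mem_trivialCofibrations_iff _).1 (trivialCofibrations_app_of_llp d.i d.hi a)).2
    have hp : pointwiseWeakEquivalences V A d.p :=
      (pointwiseWeakEquivalences V A).of_precomp d.i d.p hi (by rwa [d.fac])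
    -- Retract argument: `d.p` is a trivial fibration by two-out-of-three, so `σ` lifts against it
    -- and is a retract of `d.i`.
    have := h₁ d.p ⟨d.hp, hp⟩
    exact MorphismProperty.of_retract (RetractArrow.ofLeftLiftingProperty d.fac) d.hi
  · intro F G σ h
    exact ⟨MorphismProperty.antitone_llp inf_le_left _ h, fun a =>
      ((mem_trivialCofibrations_iff _).1 (trivialCofibrations_app_of_llp σ h a)).2⟩

variable (V A) in
/-- The projective model structure on presheaves. -/
instance projectiveModelCategory : ModelCategory (Presheaf V A) :=
  letI : CategoryWithFibrations (Presheaf V A) := ⟨pointwiseFibrations V A⟩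
  letI : CategoryWithWeakEquivalences (Presheaf V A) := ⟨pointwiseWeakEquivalences V A⟩
  letI : CategoryWithCofibrations (Presheaf V A) :=
    ⟨(pointwiseFibrations V A ⊓ pointwiseWeakEquivalences V A).llp⟩
  haveI : HasFiniteLimits (Presheaf V A) := ⟨fun _ _ _ => inferInstance⟩
  haveI : HasFiniteColimits (Presheaf V A) := ⟨fun _ _ _ => inferInstance⟩
  haveI : (weakEquivalences (Presheaf V A)).HasTwoOutOfThreeProperty :=
    inferInstanceAs (pointwiseWeakEquivalences V A).HasTwoOutOfThreeProperty
  haveI : MorphismProperty.IsWeakFactorizationSystem (cofibrations (Presheaf V A))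
      (trivialFibrations (Presheaf V A)) :=
    { rlp := llp_rlp_trivialFibrations
      llp := rfl
      hasFactorization := hasFactorization_trivialFibrations }
  haveI : MorphismProperty.IsWeakFactorizationSystem (trivialCofibrations (Presheaf V A))
      (fibrations (Presheaf V A)) :=
    have e : trivialCofibrations (Presheaf V A) = (pointwiseFibrations V A).llp :=
      llp_inf_weakEquivalences
    { rlp := by rw [e]; exact llp_rlp_fibrations
      llp := e.symm
      hasFactorization := by rw [e]; exact hasFactorization_fibrations }
  -- Retract stability of weak equivalences is not among the inputs: it follows from the two weak
  -- factorization systems and two-out-of-three.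
  ModelCategory.mk' (Presheaf V A)

lemma isProjective_projectiveModelCategory : IsProjective (projectiveModelCategory V A) where
  weakEquivalence_iff σ := HomotopicalAlgebra.weakEquivalence_iff σ
  fibration_iff σ := HomotopicalAlgebra.fibration_iff σ

end

end Presheaf

/-! ### Saturation and detection of weak equivalences by homotopy classes. -/

section ModelCategories

variable {C : Type u₁} [Category.{v₁} C] [ModelCategory C]

instance isIso_localization_map {X Y : C} (f : X ⟶ Y) [WeakEquivalence f] :
    IsIso ((weakEquivalences C).Q.map f) :=
  Localization.inverts (weakEquivalences C).Q (weakEquivalences C) f (mem_weakEquivalences _)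

/-- Fibrations of bifibrant objects which become invertible in the homotopy category are
weak equivalences. -/
lemma weakEquivalence_of_fibration_of_isIso_map {X Y : C} [IsCofibrant X] [IsFibrant X]
    [IsCofibrant Y] [IsFibrant Y] (p : X ⟶ Y) [Fibration p]
    (hp : IsIso ((weakEquivalences C).Q.map p)) : WeakEquivalence p := by
  obtain ⟨g, hg⟩ := map_surjective_of_isLocalization (weakEquivalences C).Q Y X
    (inv ((weakEquivalences C).Q.map p))
  have h₁ : LeftHomotopyRel (g ≫ p) (𝟙 Y) := by
    rw [LeftHomotopyRel.iff_map_eq (weakEquivalences C).Q]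
    simp [hg]
  -- The homotopy from `g ≫ p` to `𝟙 Y` is lifted along `p`, starting at `g`; its other end `s` is a
  -- strict section of `p`.
  obtain ⟨P, _, ⟨h⟩⟩ := h₁.exists_good_cylinder
  obtain ⟨s, h', hs⟩ := h.covering_homotopy p g
  have hsp : s ≫ p = 𝟙 Y := by
    rw [← h'.h₁, Category.assoc, hs, h.h₁]
  have h₂ : RightHomotopyRel (p ≫ s) (𝟙 X) := by
    rw [RightHomotopyRel.iff_map_eq (weakEquivalences C).Q, ← cancel_mono
      ((weakEquivalences C).Q.map p), ← Functor.map_comp, ← Functor.map_comp, Category.assoc, hsp,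
      Category.comp_id, Category.id_comp]
  obtain ⟨P', ⟨k⟩⟩ := h₂
  have : WeakEquivalence (p ≫ s) := k.weakEquivalence_iff.2 inferInstance
  -- Since `s` is a section, `p` is a retract of `p ≫ s`, which is homotopic to the identity.
  let r : RetractArrow p (p ≫ s) :=
    { i := Arrow.homMk (𝟙 X) s
      r := Arrow.homMk (𝟙 X) p (by simp [hsp])
      retract := by
        ext
        · simp
        · exact hsp }
  rw [weakEquivalence_iff]
  exact MorphismProperty.of_retract r (mem_weakEquivalences _)

/-- Maps of cofibrant objects which become invertible in the homotopy category are
weak equivalences. -/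
lemma weakEquivalence_of_isIso_map {X Y : C} [IsCofibrant X] [IsCofibrant Y] (f : X ⟶ Y)
    (hf : IsIso ((weakEquivalences C).Q.map f)) : WeakEquivalence f := by
  wlog h : IsFibrant X ∧ IsFibrant Y generalizing X Y
  · rw [← FibrantObject.HoCat.weakEquivalence_resolutionMap_iff]
    refine this _ ?_ ⟨inferInstance, inferInstance⟩
    have e := congrArg (weakEquivalences C).Q.map (FibrantObject.HoCat.resolutionMap_fac f)
    rw [Functor.map_comp, Functor.map_comp] at e
    have : IsIso ((weakEquivalences C).Q.map (FibrantObject.HoCat.iResolutionObj X) ≫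
        (weakEquivalences C).Q.map (FibrantObject.HoCat.resolutionMap f)) := by
      rw [e]
      infer_instance
    exact IsIso.of_isIso_comp_left
      ((weakEquivalences C).Q.map (FibrantObject.HoCat.iResolutionObj X)) _
  obtain ⟨_, _⟩ := h
  have d := MorphismProperty.factorizationData (trivialCofibrations C) (fibrations C) f
  have : IsFibrant d.Z := isFibrant_of_fibration d.p
  have : IsCofibrant d.Z := isCofibrant_of_cofibration d.i
  have e := congrArg (weakEquivalences C).Q.map d.fac
  rw [Functor.map_comp] at e
  have : IsIso ((weakEquivalences C).Q.map d.i ≫ (weakEquivalences C).Q.map d.p) := by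
    rwa [e]
  have := weakEquivalence_of_fibration_of_isIso_map d.p
    (IsIso.of_isIso_comp_left ((weakEquivalences C).Q.map d.i) _)
  rw [← d.fac]
  infer_instance

/-- A map of cofibrant objects is a weak equivalence if it induces bijections on homotopy classes
of maps to fibrant objects. -/
lemma weakEquivalence_of_bijective_precomp {X Y : C} [IsCofibrant X] [IsCofibrant Y] (f : X ⟶ Y)
    (hs : ∀ (Z : C) [IsFibrant Z] (g : X ⟶ Z), ∃ h : Y ⟶ Z,
      (weakEquivalences C).Q.map (f ≫ h) = (weakEquivalences C).Q.map g)
    (hi : ∀ (Z : C) [IsFibrant Z] (h h' : Y ⟶ Z),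
      (weakEquivalences C).Q.map (f ≫ h) = (weakEquivalences C).Q.map (f ≫ h') →
        (weakEquivalences C).Q.map h = (weakEquivalences C).Q.map h') :
    WeakEquivalence f := by
  apply weakEquivalence_of_isIso_map
  -- The inverse of `f` in the homotopy category is sought as a map from `Y` to a fibrant resolution
  -- of `X`, since the hypotheses only concern fibrant targets.
  set r := FibrantObject.HoCat.iResolutionObj X
  set s := FibrantObject.HoCat.iResolutionObj Y
  set f' := FibrantObject.HoCat.resolutionMap f
  have fac : r ≫ f' = f ≫ s := FibrantObject.HoCat.resolutionMap_fac f
  obtain ⟨h, hh⟩ := hs _ r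
  have h₁ : (weakEquivalences C).Q.map (h ≫ f') = (weakEquivalences C).Q.map s := by
    apply hi
    rw [← Category.assoc, Functor.map_comp, hh, ← Functor.map_comp, fac]
  rw [Functor.map_comp] at hh h₁
  have h₂ : (weakEquivalences C).Q.map r ≫ (weakEquivalences C).Q.map f' =
      (weakEquivalences C).Q.map f ≫ (weakEquivalences C).Q.map s := by
    rw [← Functor.map_comp, fac, Functor.map_comp]
  refine ⟨(weakEquivalences C).Q.map h ≫ inv ((weakEquivalences C).Q.map r), ?_, ?_⟩
  · rw [reassoc_of% hh, IsIso.hom_inv_id]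
  · rw [← cancel_mono ((weakEquivalences C).Q.map s), Category.assoc, Category.assoc, ← h₂,
      IsIso.inv_hom_id_assoc, h₁, Category.id_comp]

/-- A map of cofibrant objects is a weak equivalence if it induces bijections on homotopy classes
of maps from cofibrant objects. -/
lemma weakEquivalence_of_bijective_postcomp {X Y : C} [IsCofibrant X] [IsCofibrant Y] (f : X ⟶ Y)
    (hs : ∀ (T : C) [IsCofibrant T] (g : T ⟶ Y), ∃ h : T ⟶ X,
      (weakEquivalences C).Q.map (h ≫ f) = (weakEquivalences C).Q.map g)
    (hi : ∀ (T : C) [IsCofibrant T] (h h' : T ⟶ X),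
      (weakEquivalences C).Q.map (h ≫ f) = (weakEquivalences C).Q.map (h' ≫ f) →
        (weakEquivalences C).Q.map h = (weakEquivalences C).Q.map h') :
    WeakEquivalence f := by
  apply weakEquivalence_of_isIso_map
  obtain ⟨h, hh⟩ := hs Y (𝟙 Y)
  refine ⟨(weakEquivalences C).Q.map h, ?_, ?_⟩
  · rw [← Functor.map_comp, ← CategoryTheory.Functor.map_id]
    apply hi
    rw [Category.assoc, Functor.map_comp, hh, ← Functor.map_comp, Category.id_comp,
      Category.comp_id]
  · rw [← Functor.map_comp, hh, CategoryTheory.Functor.map_id]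

lemma exists_map_precomp_eq {X Y Z : C} [IsCofibrant Y] [IsFibrant Z] (f : X ⟶ Y)
    [WeakEquivalence f] (g : X ⟶ Z) : ∃ h : Y ⟶ Z,
      (weakEquivalences C).Q.map (f ≫ h) = (weakEquivalences C).Q.map g := by
  obtain ⟨h, hh⟩ := map_surjective_of_isLocalization (weakEquivalences C).Q Y Z
    (inv ((weakEquivalences C).Q.map f) ≫ (weakEquivalences C).Q.map g)
  exact ⟨h, by simp [hh]⟩

lemma exists_map_postcomp_eq {X Y Z : C} [IsCofibrant X] [IsFibrant Y] (f : Y ⟶ Z)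
    [WeakEquivalence f] (g : X ⟶ Z) : ∃ h : X ⟶ Y,
      (weakEquivalences C).Q.map (h ≫ f) = (weakEquivalences C).Q.map g := by
  obtain ⟨h, hh⟩ := map_surjective_of_isLocalization (weakEquivalences C).Q X Y
    ((weakEquivalences C).Q.map g ≫ inv ((weakEquivalences C).Q.map f))
  exact ⟨h, by simp [hh]⟩

/-! ### Quillen adjunctions and homotopy classes. -/

section Adjunctions

variable {D : Type u₂} [Category.{v₂} D] [ModelCategory D] {F : C ⥤ D} {G : D ⥤ C} {adj : F ⊣ G}

namespace IsQuillenAdjunction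

lemma of_fibration_map
    (h₁ : ∀ {X Y : D} (p : X ⟶ Y), fibrations D p → fibrations C (G.map p))
    (h₂ : ∀ {X Y : D} (p : X ⟶ Y), trivialFibrations D p → trivialFibrations C (G.map p)) :
    IsQuillenAdjunction adj where
  cofibration_map f hf := by
    rw [cofibration_iff, ← MorphismProperty.llp_eq_of_wfs (cofibrations D) (trivialFibrations D)]
    intro X Y p hp
    rw [adj.hasLiftingProperty_iff]
    obtain ⟨_, _⟩ := (mem_trivialFibrations_iff _).1 (h₂ p hp)
    infer_instance
  weakEquivalence_map f hf hf' := by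
    refine ((mem_trivialCofibrations_iff _).1 ?_).2
    rw [← MorphismProperty.llp_eq_of_wfs (trivialCofibrations D) (fibrations D)]
    intro X Y p hp
    rw [adj.hasLiftingProperty_iff]
    have := (fibration_iff _).2 (h₁ p hp)
    infer_instance

variable (hadj : IsQuillenAdjunction adj)
include hadj

lemma fibration_map {X Y : D} (p : X ⟶ Y) (hp : Fibration p) : Fibration (G.map p) := by
  rw [fibration_iff, ← MorphismProperty.rlp_eq_of_wfs (trivialCofibrations C) (fibrations C)]
  intro S T i hi
  rw [mem_trivialCofibrations_iff] at hi
  rw [← adj.hasLiftingProperty_iff]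
  have := hadj.cofibration_map i hi.1
  have := hadj.weakEquivalence_map i hi.1 hi.2
  infer_instance

lemma trivialFibration_map {X Y : D} (p : X ⟶ Y) (hp : trivialFibrations D p) :
    trivialFibrations C (G.map p) := by
  rw [mem_trivialFibrations_iff] at hp
  obtain ⟨_, _⟩ := hp
  rw [← MorphismProperty.rlp_eq_of_wfs (cofibrations C) (trivialFibrations C)]
  intro S T i hi
  rw [← cofibration_iff] at hi
  rw [← adj.hasLiftingProperty_iff]
  have := hadj.cofibration_map i hi
  infer_instance

lemma isCofibrant_obj (X : C) [IsCofibrant X] : IsCofibrant (F.obj X) := by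
  have := adj.leftAdjoint_preservesColimits
  rw [isCofibrant_iff_of_isInitial (F.map (initial.to X))
    (IsInitial.isInitialObj F _ initialIsInitial)]
  exact hadj.cofibration_map _ inferInstance

lemma isFibrant_obj (X : D) [IsFibrant X] : IsFibrant (G.obj X) := by
  have := adj.rightAdjoint_preservesLimits
  rw [isFibrant_iff_of_isTerminal (G.map (terminal.from X))
    (IsTerminal.isTerminalObj G _ terminalIsTerminal)]
  exact hadj.fibration_map _ inferInstance

/-- The transposition bijection of a Quillen adjunction is compatible with homotopies. -/
lemma map_homEquiv_eq_iff {X : C} {Y : D} [IsCofibrant X] [IsFibrant Y] (f g : F.obj X ⟶ Y) :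
    (weakEquivalences C).Q.map (adj.homEquiv X Y f) =
        (weakEquivalences C).Q.map (adj.homEquiv X Y g) ↔
      (weakEquivalences D).Q.map f = (weakEquivalences D).Q.map g := by
  have := hadj.isCofibrant_obj X
  have := hadj.isFibrant_obj Y
  constructor
  · rw [← LeftHomotopyRel.iff_map_eq]
    intro h
    obtain ⟨P, _, ⟨h⟩⟩ := h.exists_good_cylinder
    -- `P.i₀` is a trivial cofibration, so `F` keeps it, and hence `P.π`, a weak equivalence. The
    -- images of `P.i₀` and `P.i₁` then agree in the homotopy category, both being sections of that
    -- of `P.π`.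
    have := hadj.weakEquivalence_map P.i₀ inferInstance inferInstance
    have hπ : WeakEquivalence (F.map P.π) :=
      weakEquivalence_of_precomp_of_fac (f := F.map P.i₀) (fg := 𝟙 _)
        (by rw [← Functor.map_comp, P.i₀_π, CategoryTheory.Functor.map_id])
    have e : (weakEquivalences D).Q.map (F.map P.i₀) =
        (weakEquivalences D).Q.map (F.map P.i₁) := by
      rw [← cancel_mono ((weakEquivalences D).Q.map (F.map P.π))]
      simp only [← Functor.map_comp, P.i₀_π, P.i₁_π]
    have hf : F.map P.i₀ ≫ (adj.homEquiv _ _).symm h.h = f := by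
      rw [← adj.homEquiv_naturality_left_symm, h.h₀, Equiv.symm_apply_apply]
    have hg : F.map P.i₁ ≫ (adj.homEquiv _ _).symm h.h = g := by
      rw [← adj.homEquiv_naturality_left_symm, h.h₁, Equiv.symm_apply_apply]
    refine (congrArg _ hf).symm.trans (Eq.trans ?_ (congrArg _ hg))
    rw [Functor.map_comp, Functor.map_comp, e]
  · rw [← RightHomotopyRel.iff_map_eq]
    intro h
    obtain ⟨P, _, ⟨h⟩⟩ := h.exists_good_pathObject
    have := ((mem_trivialFibrations_iff _).1
      (hadj.trivialFibration_map P.p₀ (mem_trivialFibrations _))).2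
    have hι : WeakEquivalence (G.map P.ι) :=
      weakEquivalence_of_postcomp_of_fac (g := G.map P.p₀) (fg := 𝟙 _)
        (by rw [← Functor.map_comp, P.ι_p₀, CategoryTheory.Functor.map_id])
    have e : (weakEquivalences C).Q.map (G.map P.p₀) =
        (weakEquivalences C).Q.map (G.map P.p₁) := by
      rw [← cancel_epi ((weakEquivalences C).Q.map (G.map P.ι))]
      simp only [← Functor.map_comp, P.ι_p₀, P.ι_p₁]
    refine (congrArg (fun k => (weakEquivalences C).Q.map (adj.homEquiv X Y k)) h.h₀).symm.trans
      (Eq.trans ?_ (congrArg (fun k => (weakEquivalences C).Q.map (adj.homEquiv X Y k)) h.h₁))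
    rw [adj.homEquiv_naturality_right, adj.homEquiv_naturality_right, Functor.map_comp,
      Functor.map_comp, e]

end IsQuillenAdjunction

/-- Let `F ⊣ G`, `E ⊣ R` and `G ⋙ E ⊣ R'` be Quillen adjunctions. If the comparison map
`G (R' Z) ⟶ R Z` is a weak equivalence for all fibrant `Z`, then the image by `E` of the unit
`M ⟶ G (F M)` is a weak equivalence for all cofibrant `M`. -/
lemma weakEquivalence_map_unit {H : Type u} [Category.{v} H] [ModelCategory H]
    [∀ X : H, IsCofibrant X] (hadj : IsQuillenAdjunction adj)
    {E : C ⥤ H} {R : H ⥤ C} {adjE : E ⊣ R} (hE : IsQuillenAdjunction adjE)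
    {R' : H ⥤ D} {adjE' : G ⋙ E ⊣ R'} (hE' : IsQuillenAdjunction adjE')
    (hρ : ∀ (Z : H) [IsFibrant Z],
      WeakEquivalence (adjE.homEquiv (G.obj (R'.obj Z)) Z (adjE'.counit.app Z)))
    (M : C) [IsCofibrant M] : WeakEquivalence (E.map (adj.unit.app M)) := by
  -- Under the adjunctions, precomposition with `E` of the unit becomes postcomposition with the
  -- comparison map, which is bijective on homotopy classes.
  have key (Z : H) (k : E.obj (G.obj (F.obj M)) ⟶ Z) :
      adjE.homEquiv M Z (E.map (adj.unit.app M) ≫ k) =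
        adj.homEquiv M (R'.obj Z) (adjE'.homEquiv (F.obj M) Z k) ≫
          adjE.homEquiv (G.obj (R'.obj Z)) Z (adjE'.counit.app Z) := by
    obtain ⟨k, rfl⟩ := (adjE'.homEquiv (F.obj M) Z).symm.surjective k
    rw [Equiv.apply_symm_apply, adj.homEquiv_unit, adjE'.homEquiv_counit]
    refine (adjE.homEquiv_naturality_left _ _).trans (Eq.trans ?_ (Category.assoc _ _ _).symm)
    exact congrArg (adj.unit.app M ≫ ·) (adjE.homEquiv_naturality_left (G.map k) _)
  have := hadj.isCofibrant_obj M
  refine weakEquivalence_of_bijective_precomp (X := E.obj M) (Y := E.obj (G.obj (F.obj M)))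
    (E.map (adj.unit.app M)) (fun Z _ g => ?_) (fun Z _ k k' hk => ?_)
  · have := hE'.isFibrant_obj Z
    have := hadj.isFibrant_obj (R'.obj Z)
    have := hρ Z
    obtain ⟨t, ht⟩ := exists_map_postcomp_eq
      (adjE.homEquiv (G.obj (R'.obj Z)) Z (adjE'.counit.app Z)) (adjE.homEquiv M Z g)
    refine ⟨(adjE'.homEquiv (F.obj M) Z).symm ((adj.homEquiv M (R'.obj Z)).symm t), ?_⟩
    rw [← hE.map_homEquiv_eq_iff (X := M), key, Equiv.apply_symm_apply, Equiv.apply_symm_apply, ht]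
  · have := hE'.isFibrant_obj Z
    have := hρ Z
    rw [← hE.map_homEquiv_eq_iff (X := M), key, key, Functor.map_comp, Functor.map_comp,
      cancel_mono, hadj.map_homEquiv_eq_iff, hE'.map_homEquiv_eq_iff] at hk
    exact hk

end Adjunctions

end ModelCategories

/-! ### Homotopy invariance of internal homs into fibrant objects. -/

section MonoidalModel

variable {V : Type u} [Category.{v} V] [MonoidalCategory V] [SymmetricCategory V]
  [MonoidalClosed V] [ModelCategory V] [MonoidalModelCategory V] [∀ X : V, IsCofibrant X]

lemma isQuillenAdjunction_tensorLeft (X : V) : IsQuillenAdjunction (ihom.adjunction X) where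
  cofibration_map f hf := cofibration_whiskerLeft X f hf
  weakEquivalence_map f hf hf' := weakEquivalence_whiskerLeft_of_cofibration X f hf hf'

/-- Internal homs to a fibrant object preserve weak equivalences. -/
lemma weakEquivalence_pre_app {X Y : V} (f : X ⟶ Y) (hf : WeakEquivalence f) (Z : V)
    [IsFibrant Z] : WeakEquivalence ((MonoidalClosed.pre f).app Z) := by
  have (T : V) : WeakEquivalence (f ▷ T) := by
    rw [weakEquivalence_iff] at hf ⊢
    exact MorphismProperty.whiskerRight_mem (weakEquivalences V) f hf T
  have hX := isQuillenAdjunction_tensorLeft X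
  have hY := isQuillenAdjunction_tensorLeft Y
  -- Postcomposition with `[f, Z]` corresponds to precomposition with the weak equivalence `f ▷ T`.
  have key (T : V) (k : Y ⊗ T ⟶ Z) : (ihom.adjunction Y).homEquiv T Z k ≫
      (MonoidalClosed.pre f).app Z = (ihom.adjunction X).homEquiv T Z (f ▷ T ≫ k) :=
    MonoidalClosed.curry_pre_app f k
  refine weakEquivalence_of_bijective_postcomp _ (fun T _ g => ?_) (fun T _ h h' e => ?_)
  · obtain ⟨k, hk⟩ := exists_map_precomp_eq (f ▷ T) (((ihom.adjunction X).homEquiv T Z).symm g)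
    refine ⟨(ihom.adjunction Y).homEquiv T Z k, ?_⟩
    obtain ⟨g, rfl⟩ := ((ihom.adjunction X).homEquiv T Z).surjective g
    rw [Equiv.symm_apply_apply] at hk
    rw [key]
    exact (hX.map_homEquiv_eq_iff _ _).2 hk
  · obtain ⟨h, rfl⟩ := ((ihom.adjunction Y).homEquiv T Z).surjective h
    obtain ⟨h', rfl⟩ := ((ihom.adjunction Y).homEquiv T Z).surjective h'
    rw [key, key] at e
    have e := (hX.map_homEquiv_eq_iff _ _).1 e
    rw [Functor.map_comp, Functor.map_comp, cancel_epi] at e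
    exact (hY.map_homEquiv_eq_iff _ _).2 e

end MonoidalModel

/-! ### Restriction and left Kan extension. -/

namespace Presheaf

section Free

variable {V : Type u} [Category.{v} V] [MonoidalCategory V] [SymmetricCategory V]
  [MonoidalClosed V] {A : Type u₁} [EnrichedCategory V A]

lemma freeUnit_app_freeDesc {a : Aᵒᵖ} {X : V} {F : Presheaf V A} (g : X ⟶ F.toFunctor.obj a) :
    freeUnit a X ≫ Hom.app (freeDesc g) a = g :=
  (freeHomEquiv a X F).apply_symm_apply g

lemma free_hom_ext {a : Aᵒᵖ} {X : V} {F : Presheaf V A} {σ τ : freeObj a X ⟶ F}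
    (h : freeUnit a X ≫ Hom.app σ a = freeUnit a X ≫ Hom.app τ a) : σ = τ :=
  (freeHomEquiv a X F).injective h

end Free

section Restriction

variable {V : Type u} [Category.{v} V] [MonoidalCategory V] [SymmetricCategory V]
  [MonoidalClosed V] {A : Type u₁} [EnrichedCategory V A] {B : Type u₂} [EnrichedCategory V B]
  (W : EnrichedFunctor V A B)

lemma restriction_act (G : Presheaf V B) (a b : Aᵒᵖ) :
    ((restriction W).obj G).act a b =
      G.toFunctor.obj ((opFunctor W).obj a) ◁ (opFunctor W).map a b ≫
        G.act ((opFunctor W).obj a) ((opFunctor W).obj b) :=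
  MonoidalClosed.uncurry_natural_left (A := G.toFunctor.obj ((opFunctor W).obj a))
    ((opFunctor W).map a b) (G.toFunctor.map ((opFunctor W).obj a) ((opFunctor W).obj b))

/-- A family of morphisms `F a ⟶ G (W a)` is natural if it defines a morphism from `F` to the
restriction of `G`. -/
def IsNaturalFamily {F : Presheaf V A} {G : Presheaf V B}
    (t : ∀ a, F.toFunctor.obj a ⟶ G.toFunctor.obj ((opFunctor W).obj a)) : Prop :=
  ∀ a b, F.act a b ≫ t b = t a ▷ _ ≫ ((restriction W).obj G).act a b

/-- The family of morphisms underlying a morphism to a restriction. -/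
def toFamily {F : Presheaf V A} {G : Presheaf V B} (σ : F ⟶ (restriction W).obj G) (a : Aᵒᵖ) :
    F.toFunctor.obj a ⟶ G.toFunctor.obj ((opFunctor W).obj a) :=
  Hom.app σ a

lemma isNaturalFamily_toFamily {F : Presheaf V A} {G : Presheaf V B}
    (σ : F ⟶ (restriction W).obj G) : IsNaturalFamily W (toFamily W σ) :=
  act_app σ

end Restriction

section LeftKanExtension

variable {V : Type u} [Category.{v} V] [MonoidalCategory V] [SymmetricCategory V]
  [MonoidalClosed V] {A : Type v} [EnrichedCategory V A] {B : Type u₂} [EnrichedCategory V B]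
  (W : EnrichedFunctor V A B)

variable [IsLocallyPresentable.{v} V]

variable (F : Presheaf V A)

/-- The generators of the left Kan extension of a presheaf. -/
abbrev lanGenerators : Presheaf V B :=
  ∐ fun a : Aᵒᵖ => freeObj ((opFunctor W).obj a) (F.toFunctor.obj a)

/-- The universal family to the generators of the left Kan extension. -/
def lanι (a : Aᵒᵖ) :
    F.toFunctor.obj a ⟶ (lanGenerators W F).toFunctor.obj ((opFunctor W).obj a) :=
  freeUnit _ _ ≫ Hom.app (Sigma.ι
    (fun a : Aᵒᵖ => freeObj (V := V) ((opFunctor W).obj a) (F.toFunctor.obj a)) a) _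

variable {F} {G : Presheaf V B}

/-- The morphism from the generators of the left Kan extension induced by a family. -/
def lanDesc (t : ∀ a, F.toFunctor.obj a ⟶ G.toFunctor.obj ((opFunctor W).obj a)) :
    lanGenerators W F ⟶ G :=
  Sigma.desc fun a => freeDesc (a := (opFunctor W).obj a) (t a)

lemma lanι_lanDesc (t : ∀ a, F.toFunctor.obj a ⟶ G.toFunctor.obj ((opFunctor W).obj a))
    (a : Aᵒᵖ) : lanι W F a ≫ Hom.app (lanDesc W t) ((opFunctor W).obj a) = t a := by
  rw [lanι, Category.assoc, ← comp_app, lanDesc, Sigma.ι_desc]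
  exact freeUnit_app_freeDesc (t a)

lemma lanGenerators_hom_ext {k k' : lanGenerators W F ⟶ G}
    (h : ∀ a, lanι W F a ≫ Hom.app k ((opFunctor W).obj a) =
      lanι W F a ≫ Hom.app k' ((opFunctor W).obj a)) : k = k' := by
  refine Sigma.hom_ext _ _ fun a => free_hom_ext ?_
  have := h a
  rwa [lanι, Category.assoc, Category.assoc, ← comp_app, ← comp_app] at this

variable (F)

/-- The relations of the left Kan extension of a presheaf. -/
abbrev lanRelations : Presheaf V B :=
  ∐ fun p : Aᵒᵖ × Aᵒᵖ =>
    freeObj ((opFunctor W).obj p.2) (F.toFunctor.obj p.1 ⊗ (p.1 ⟶[V] p.2))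

/-- The morphism from the relations given by the action on the presheaf. -/
def lanLeft : lanRelations W F ⟶ lanGenerators W F :=
  Sigma.desc fun p => freeDesc (F.act p.1 p.2 ≫ lanι W F p.2)

/-- The morphism from the relations given by the action on the generators. -/
def lanRight : lanRelations W F ⟶ lanGenerators W F :=
  Sigma.desc fun p => freeDesc
    (lanι W F p.1 ▷ _ ≫ ((restriction W).obj (lanGenerators W F)).act p.1 p.2)

variable {F}

/-- On the summand indexed by `(a, b)`, the equation transposes under the free adjunction to the
naturality square at `a` and `b`. -/
lemma lanLeft_comp_eq_iff (k : lanGenerators W F ⟶ G) :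
    lanLeft W F ≫ k = lanRight W F ≫ k ↔
      IsNaturalFamily W fun a => lanι W F a ≫ Hom.app k ((opFunctor W).obj a) := by
  have key (a b : Aᵒᵖ) :
      Sigma.ι (fun p : Aᵒᵖ × Aᵒᵖ => freeObj (V := V) ((opFunctor W).obj p.2)
          (F.toFunctor.obj p.1 ⊗ (p.1 ⟶[V] p.2))) (a, b) ≫ lanLeft W F ≫ k =
        Sigma.ι (fun p : Aᵒᵖ × Aᵒᵖ => freeObj (V := V) ((opFunctor W).obj p.2)
          (F.toFunctor.obj p.1 ⊗ (p.1 ⟶[V] p.2))) (a, b) ≫ lanRight W F ≫ k ↔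
      F.act a b ≫ lanι W F b ≫ Hom.app k ((opFunctor W).obj b) =
        (lanι W F a ≫ Hom.app k ((opFunctor W).obj a)) ▷ _ ≫
          ((restriction W).obj G).act a b := by
    rw [lanLeft, lanRight, Sigma.ι_desc_assoc, Sigma.ι_desc_assoc]
    refine (freeHomEquiv ((opFunctor W).obj b) (F.toFunctor.obj a ⊗ (a ⟶[V] b))
      G).injective.eq_iff.symm.trans (Eq.congr ?_ ?_)
    · refine (Category.assoc _ _ _).symm.trans ?_
      refine (congrArg (· ≫ Hom.app k _) (freeUnit_app_freeDesc (F.act a b ≫ lanι W F b))).trans ?_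
      exact Category.assoc _ _ _
    · refine (Category.assoc _ _ _).symm.trans ?_
      refine (congrArg (· ≫ Hom.app k _) (freeUnit_app_freeDesc (V := V)
        (a := (opFunctor W).obj b) (F := lanGenerators W F) (lanι W F a ▷ (a ⟶[V] b) ≫
        ((restriction W).obj (lanGenerators W F)).act a b))).trans ?_
      refine (Category.assoc _ _ _).trans ?_
      refine (congrArg (_ ≫ ·) (act_app ((restriction W).map k) a b)).trans ?_
      refine (Category.assoc _ _ _).symm.trans ?_
      exact congrArg (· ≫ _) (comp_whiskerRight _ _ _).symm
  constructor
  · intro h a b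
    exact (key a b).1 (by rw [h])
  · intro h
    exact Sigma.hom_ext _ _ fun p => (key p.1 p.2).2 (h p.1 p.2)

variable (F)

/-- The left Kan extension of a presheaf along a `V`-functor. -/
abbrev lan : Presheaf V B := coequalizer (lanLeft W F) (lanRight W F)

/-- The universal property of the left Kan extension. -/
def lanHomEquiv (G : Presheaf V B) : (lan W F ⟶ G) ≃ (F ⟶ (restriction W).obj G) where
  toFun k := homMk (fun a => lanι W F a ≫
    Hom.app (coequalizer.π (lanLeft W F) (lanRight W F) ≫ k) ((opFunctor W).obj a))
      ((lanLeft_comp_eq_iff W _).1 (coequalizer.condition_assoc _ _ _))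
  invFun σ := coequalizer.desc (lanDesc W (toFamily W σ))
    ((lanLeft_comp_eq_iff W _).2 (by
      simp only [lanι_lanDesc]
      exact isNaturalFamily_toFamily W σ))
  left_inv k := by
    refine coequalizer.hom_ext (Eq.trans (coequalizer.π_desc _ _) ?_)
    exact lanGenerators_hom_ext W fun a => lanι_lanDesc W _ a
  right_inv σ := by
    ext a
    change lanι W F a ≫ Hom.app (coequalizer.π (lanLeft W F) (lanRight W F) ≫
      coequalizer.desc _ _) ((opFunctor W).obj a) = _
    rw [coequalizer.π_desc]
    exact lanι_lanDesc W (toFamily W σ) a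

end LeftKanExtension

section

variable {V : Type u} [Category.{v} V] [MonoidalCategory V] [SymmetricCategory V]
  [MonoidalClosed V] {A : Type v} [EnrichedCategory V A] {B : Type v} [EnrichedCategory V B]
  (W : EnrichedFunctor V A B) [IsLocallyPresentable.{v} V]

instance isRightAdjoint_restriction : (restriction W).IsRightAdjoint :=
  (Adjunction.adjunctionOfEquivLeft (G := restriction W) (lanHomEquiv W)
    fun F G G' g k => by
      ext a
      change lanι W F a ≫ Hom.app (coequalizer.π (lanLeft W F) (lanRight W F) ≫ k ≫ g)
        ((opFunctor W).obj a) = (lanι W F a ≫ Hom.app (coequalizer.π (lanLeft W F)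
          (lanRight W F) ≫ k) ((opFunctor W).obj a)) ≫ Hom.app g _
      rw [Category.assoc, ← comp_app, Category.assoc]).isRightAdjoint

end

end Presheaf

/-! ### Homotopy equivalences act by weak equivalences. -/

namespace Presheaf

section LeftAction

variable {V : Type u} [Category.{v} V] [MonoidalCategory V] [SymmetricCategory V]
  [MonoidalClosed V] {B : Type u₂} [EnrichedCategory V B] (N : Presheaf V B)

omit [MonoidalClosed V] in
lemma braiding_tensor_left_whiskerLeft_braiding (X Y Z : V) :
    (β_ (X ⊗ Y) Z).hom ≫ Z ◁ (β_ X Y).hom ≫ (α_ Z Y X).inv =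
      (α_ X Y Z).hom ≫ X ◁ (β_ Y Z).hom ≫ (β_ X (Z ⊗ Y)).hom := by
  rw [BraidedCategory.braiding_tensor_left_hom, BraidedCategory.braiding_tensor_right_hom]
  simp only [Category.assoc]

/-- The left action `B(Z, Y) ⊗ N Y ⟶ N Z` of the hom-objects on a presheaf. -/
def leftAct (Z Y : B) :
    (Z ⟶[V] Y) ⊗ N.toFunctor.obj (op Y) ⟶ N.toFunctor.obj (op Z) :=
  (β_ _ _).hom ≫ N.act (op Y) (op Z)

lemma eId_whiskerRight_leftAct (Z : B) :
    eId V Z ▷ N.toFunctor.obj (op Z) ≫ N.leftAct Z Z = (λ_ _).hom := by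
  have := whiskerLeft_eId_act N (op Z)
  rw [leftAct, BraidedCategory.braiding_naturality_left_assoc]
  refine (congrArg (_ ≫ ·) this).trans ?_
  simp

/-- Composition in `Bᵒᵖ` is composition in `B` after a braiding, so associativity of the right
action becomes that of the left action by the hexagon identities. -/
lemma eComp_whiskerRight_leftAct (Z Y X : B) :
    eComp V Z Y X ▷ N.toFunctor.obj (op X) ≫ N.leftAct Z X =
      (α_ _ _ _).hom ≫ (Z ⟶[V] Y) ◁ N.leftAct Y X ≫ N.leftAct Z Y := by
  have h : eComp V Z Y X = (β_ _ _).hom ≫ eComp V (op X) (op Y) (op Z) :=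
    (SymmetricCategory.symmetry_assoc (Z ⟶[V] Y) (Y ⟶[V] X) _).symm
  rw [leftAct, leftAct, leftAct, BraidedCategory.braiding_naturality_left_assoc, h,
    MonoidalCategory.whiskerLeft_comp, MonoidalCategory.whiskerLeft_comp, Category.assoc,
    Category.assoc, BraidedCategory.braiding_naturality_right_assoc]
  refine (congrArg (fun t => _ ≫ _ ≫ t) (whiskerLeft_eComp_act N (op X) (op Y) (op Z))).trans ?_
  exact (reassoc_of% braiding_tensor_left_whiskerLeft_braiding (Z ⟶[V] Y) (Y ⟶[V] X)
    (N.toFunctor.obj (op X))) _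

lemma leftAct_app {N N' : Presheaf V B} (σ : N ⟶ N') {Z Y : B} (f : 𝟙_ V ⟶ (Z ⟶[V] Y)) :
    ((λ_ _).inv ≫ f ▷ _ ≫ N.leftAct Z Y) ≫ Hom.app σ (op Z) =
      Hom.app σ (op Y) ≫ (λ_ _).inv ≫ f ▷ _ ≫ N'.leftAct Z Y := by
  have := act_app σ (op Y) (op Z)
  simp only [leftAct, Category.assoc, this]
  rw [leftUnitor_inv_naturality_assoc, whisker_exchange_assoc,
    BraidedCategory.braiding_naturality_right_assoc]
  rfl

end LeftAction

section Homotopy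

variable {V : Type u} [Category.{v} V] [MonoidalCategory V] [SymmetricCategory V]
  [MonoidalClosed V] {B : Type u₂} [EnrichedCategory V B] (N : Presheaf V B)
  {H : Type u₁} [Category.{v₁} H] [MonoidalCategory H] (P : V ⥤ H) [P.LaxMonoidal]

/-- The action of a morphism `𝟙_ H ⟶ P (B(Z, Y))` on the image by `P` of a presheaf. -/
def transportAct {Z Y : B} (φ : 𝟙_ H ⟶ P.obj (Z ⟶[V] Y)) :
    P.obj (N.toFunctor.obj (op Y)) ⟶ P.obj (N.toFunctor.obj (op Z)) :=
  (λ_ _).inv ≫ φ ▷ _ ≫ Functor.LaxMonoidal.μ P _ _ ≫ P.map (N.leftAct Z Y)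

lemma transportAct_ε_map {Z Y : B} (f : 𝟙_ V ⟶ (Z ⟶[V] Y)) :
    N.transportAct P (Functor.LaxMonoidal.ε P ≫ P.map f) =
      P.map ((λ_ _).inv ≫ f ▷ _ ≫ N.leftAct Z Y) := by
  rw [transportAct, comp_whiskerRight_assoc, Functor.LaxMonoidal.μ_natural_left_assoc,
    P.map_comp, P.map_comp, Functor.LaxMonoidal.left_unitality_inv_assoc]

lemma transportAct_id (Z : B) :
    N.transportAct P (Functor.LaxMonoidal.ε P ≫ P.map (eId V Z)) = 𝟙 _ := by
  rw [transportAct_ε_map, eId_whiskerRight_leftAct, Iso.inv_hom_id, P.map_id]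

/-- With `transportAct_id`, this is the contravariant functoriality by which isomorphisms of `ho B`
act invertibly. -/
lemma transportAct_comp {Z Y X : B} (φ : 𝟙_ H ⟶ P.obj (Z ⟶[V] Y))
    (ψ : 𝟙_ H ⟶ P.obj (Y ⟶[V] X)) :
    N.transportAct P ((λ_ _).inv ≫ (φ ⊗ₘ ψ) ≫ Functor.LaxMonoidal.μ P _ _ ≫
        P.map (eComp V Z Y X)) = N.transportAct P ψ ≫ N.transportAct P φ := by
  simp only [transportAct, comp_whiskerRight, Category.assoc,
    Functor.LaxMonoidal.μ_natural_left_assoc]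
  rw [← P.map_comp, eComp_whiskerRight_leftAct, P.map_comp, P.map_comp,
    Functor.LaxMonoidal.associativity_assoc, ← Functor.LaxMonoidal.μ_natural_right_assoc]
  simp only [MonoidalCategory.tensorHom_def, leftUnitor_inv_naturality_assoc,
    whisker_exchange_assoc, comp_whiskerRight, Category.assoc]
  simp

end Homotopy

section HomotopyEquivalences

variable {V : Type u} [Category.{v} V] [MonoidalCategory V] [SymmetricCategory V]
  [MonoidalClosed V] [ModelCategory V] [MonoidalModelCategory V] [∀ X : V, IsCofibrant X]
  {B : Type u₂} [EnrichedCategory V B]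

lemma weakEquivalence_leftAct (N : Presheaf V B) {Z Y : B} (f : 𝟙_ V ⟶ (Z ⟶[V] Y))
    (hf : IsHomotopyEquivalence f) :
    WeakEquivalence ((λ_ _).inv ≫ f ▷ _ ≫ N.leftAct Z Y) := by
  apply weakEquivalence_of_isIso_map
  change IsIso ((toHo V).map _)
  have hf : IsIso (toHoCatMap f) := hf
  have h₁ := congrArg (ForgetEnrichment.homTo (Ho V)) (IsIso.hom_inv_id (toHoCatMap f))
  have h₂ := congrArg (ForgetEnrichment.homTo (Ho V)) (IsIso.inv_hom_id (toHoCatMap f))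
  let φ : 𝟙_ (Ho V) ⟶ (toHo V).obj (Z ⟶[V] Y) := Functor.LaxMonoidal.ε (toHo V) ≫ (toHo V).map f
  -- The inverse exists only in `ho B`: with hom-objects possibly not fibrant, it need not come from
  -- a morphism `𝟙_ V ⟶ B(Y, Z)`. Hence the action is needed for arbitrary morphisms of `Ho V`.
  let ψ : 𝟙_ (Ho V) ⟶ (toHo V).obj (Y ⟶[V] Z) :=
    ForgetEnrichment.homTo (Ho V) (inv (toHoCatMap f))
  replace h₁ : (λ_ _).inv ≫ (φ ⊗ₘ ψ) ≫ Functor.LaxMonoidal.μ (toHo V) _ _ ≫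
      (toHo V).map (eComp V Z Y Z) = Functor.LaxMonoidal.ε (toHo V) ≫ (toHo V).map (eId V Z) :=
    (Category.assoc _ _ _).symm.trans (h₁.trans (ForgetEnrichment.homTo_id (Ho V) _))
  replace h₂ : (λ_ _).inv ≫ (ψ ⊗ₘ φ) ≫ Functor.LaxMonoidal.μ (toHo V) _ _ ≫
      (toHo V).map (eComp V Y Z Y) = Functor.LaxMonoidal.ε (toHo V) ≫ (toHo V).map (eId V Y) :=
    (Category.assoc _ _ _).symm.trans (h₂.trans (ForgetEnrichment.homTo_id (Ho V) _))
  have e₁ := (N.transportAct_comp (toHo V) φ ψ).symm.trans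
    ((congrArg (N.transportAct (toHo V)) h₁).trans (N.transportAct_id (toHo V) Z))
  have e₂ := (N.transportAct_comp (toHo V) ψ φ).symm.trans
    ((congrArg (N.transportAct (toHo V)) h₂).trans (N.transportAct_id (toHo V) Y))
  rw [← transportAct_ε_map]
  exact ⟨_, e₂, e₁⟩

/-- Restriction along a Dwyer-Kan equivalence reflects componentwise weak equivalences. -/
lemma weakEquivalence_app_of_restriction {A : Type u₁} [EnrichedCategory V A]
    {W : EnrichedFunctor V A B} (hW : IsDwyerKanEquivalence W) {N N' : Presheaf V B} (σ : N ⟶ N')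
    (hσ : ∀ a, WeakEquivalence (Hom.app ((restriction W).map σ) a)) (Z : Bᵒᵖ) :
    WeakEquivalence (Hom.app σ Z) := by
  obtain ⟨X, f, hf⟩ := hW.exists_homotopyEquivalence Z.unop
  have h₁ := weakEquivalence_leftAct N f hf
  have h₂ := weakEquivalence_leftAct N' f hf
  have h₃ : WeakEquivalence (Hom.app σ (op (W.obj X))) := hσ (op X)
  have e := leftAct_app σ f
  have h₄ : WeakEquivalence (((λ_ _).inv ≫ f ▷ _ ≫ N.leftAct Z.unop (W.obj X)) ≫
      Hom.app σ (op Z.unop)) := by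
    rw [e]
    infer_instance
  exact weakEquivalence_of_precomp ((λ_ _).inv ≫ f ▷ _ ≫ N.leftAct Z.unop (W.obj X))
    (Hom.app σ (op Z.unop))

end HomotopyEquivalences

end Presheaf

/-! ### The Quillen equivalence. -/

namespace Presheaf

section RestrictionCofree

variable {V : Type u} [Category.{v} V] [MonoidalCategory V] [SymmetricCategory V]
  [MonoidalClosed V] {A : Type u₁} {B : Type u₂} [EnrichedCategory V A] [EnrichedCategory V B]
  (W : EnrichedFunctor V A B)

/-- The right adjoint of the evaluation of restrictions at an object. -/
def restrictionCofreeAdjunction (a : Aᵒᵖ) :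
    restriction W ⋙ evaluation V a ⊣ cofree ((opFunctor W).obj a) :=
  cofreeAdjunction ((opFunctor W).obj a)

/-- At `c` the transpose acts by `c ⟶ a` through `W` and then evaluates at the identity of `W a`; by
`cofreeAct_cofreeCounit` this is evaluation at the image under `W`. -/
lemma homEquiv_restrictionCofreeAdjunction_counit_app (a : Aᵒᵖ) (Z : V) (c : Aᵒᵖ) :
    Hom.app ((cofreeAdjunction a).homEquiv
      ((restriction W).obj ((cofree ((opFunctor W).obj a)).obj Z)) Z
      ((restrictionCofreeAdjunction W a).counit.app Z)) c =
    (MonoidalClosed.pre ((opFunctor W).map c a)).app Z := by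
  rw [← curryRight_eq_pre]
  set a' := (opFunctor W).obj a
  set c' := (opFunctor W).obj c
  have h₁ : (cofreeAdjunction a).homEquiv ((restriction W).obj (cofreeObj a' Z)) Z
      ((restrictionCofreeAdjunction W a).counit.app Z) =
      cofreeHomEquiv a ((restriction W).obj (cofreeObj a' Z)) Z (cofreeCounit a' Z) := by
    rw [cofreeAdjunction_homEquiv]
    exact congrArg (cofreeHomEquiv a ((restriction W).obj (cofreeObj a' Z)) Z)
      (Category.id_comp (cofreeCounit a' Z))
  refine (congrArg (fun t => Hom.app t c) h₁).trans ?_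
  change curryRight (((restriction W).obj (cofreeObj a' Z)).act c a ≫ cofreeCounit a' Z) = _
  refine congrArg curryRight ?_
  rw [restriction_act]
  refine (Category.assoc _ _ _).trans ?_
  rw [cofreeObj_act]
  exact congrArg (_ ≫ ·) (cofreeAct_cofreeCounit a' Z c')

end RestrictionCofree

section DwyerKan

variable {V : Type u} [Category.{v} V] [MonoidalCategory V] [SymmetricCategory V]
  [MonoidalClosed V] [ModelCategory V] [MonoidalModelCategory V] [CombinatorialModelCategory V]
  [∀ X : V, IsCofibrant X] {A B : Type v} [EnrichedCategory V A] [EnrichedCategory V B]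

lemma weakEquivalence_iff_app {F G : Presheaf V A} (σ : F ⟶ G) :
    WeakEquivalence σ ↔ ∀ a, WeakEquivalence (Hom.app σ a) :=
  isProjective_projectiveModelCategory.weakEquivalence_iff σ

lemma fibration_iff_app {F G : Presheaf V A} (σ : F ⟶ G) :
    Fibration σ ↔ ∀ a, Fibration (Hom.app σ a) :=
  isProjective_projectiveModelCategory.fibration_iff σ

lemma isQuillenAdjunction_cofreeAdjunction (a : Aᵒᵖ) :
    IsQuillenAdjunction (cofreeAdjunction (V := V) a) where
  cofibration_map σ hσ := cofibration_app_of_llp σ ((cofibration_iff σ).1 hσ) a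
  weakEquivalence_map σ _ hσ := (weakEquivalence_iff_app σ).1 hσ a

variable (W : EnrichedFunctor V A B)

lemma isQuillenAdjunction_restriction {L : Presheaf V A ⥤ Presheaf V B}
    (adj : L ⊣ restriction W) : IsQuillenAdjunction adj := by
  refine IsQuillenAdjunction.of_fibration_map (fun p hp => ?_) (fun p hp => ?_)
  · rw [← fibration_iff, fibration_iff_app] at hp ⊢
    exact fun a => hp ((opFunctor W).obj a)
  · rw [mem_trivialFibrations_iff, fibration_iff_app, weakEquivalence_iff_app] at hp ⊢
    exact ⟨fun a => hp.1 ((opFunctor W).obj a), fun a => hp.2 ((opFunctor W).obj a)⟩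

lemma isQuillenAdjunction_restrictionCofreeAdjunction (a : Aᵒᵖ) :
    IsQuillenAdjunction (restrictionCofreeAdjunction W a) where
  cofibration_map := (isQuillenAdjunction_cofreeAdjunction ((opFunctor W).obj a)).cofibration_map
  weakEquivalence_map :=
    (isQuillenAdjunction_cofreeAdjunction ((opFunctor W).obj a)).weakEquivalence_map

/-- The unit of the adjunction between left Kan extension and restriction along a locally weakly
invertible `V`-functor is a componentwise weak equivalence on cofibrant presheaves. -/
lemma weakEquivalence_unit_app (hW : ∀ X Y, WeakEquivalence (W.map X Y))
    {L : Presheaf V A ⥤ Presheaf V B} (adj : L ⊣ restriction W) (M : Presheaf V A)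
    [IsCofibrant M] : WeakEquivalence (adj.unit.app M) := by
  rw [weakEquivalence_iff_app]
  intro a
  -- Here `E` is evaluation at `a`, with `R = cofree a` and `R' = cofree (W a)`.
  refine weakEquivalence_map_unit (isQuillenAdjunction_restriction W adj)
    (isQuillenAdjunction_cofreeAdjunction a) (isQuillenAdjunction_restrictionCofreeAdjunction W a)
    (fun Z _ => ?_) M
  rw [weakEquivalence_iff_app]
  intro c
  rw [homEquiv_restrictionCofreeAdjunction_counit_app]
  exact weakEquivalence_pre_app _ (hW _ _) Z

lemma weakEquivalence_restriction_map_iff (hW : IsDwyerKanEquivalence W) {N N' : Presheaf V B}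
    (σ : N ⟶ N') : WeakEquivalence ((restriction W).map σ) ↔ WeakEquivalence σ := by
  rw [weakEquivalence_iff_app, weakEquivalence_iff_app]
  exact ⟨weakEquivalence_app_of_restriction hW σ, fun h a => h ((opFunctor W).obj a)⟩

lemma isQuillenEquivalence_restriction (hW : IsDwyerKanEquivalence W)
    {L : Presheaf V A ⥤ Presheaf V B} (adj : L ⊣ restriction W) : IsQuillenEquivalence adj where
  toIsQuillenAdjunction := isQuillenAdjunction_restriction W adj
  weakEquivalence_iff_homEquiv {M N} hM hN f := by
    have := weakEquivalence_unit_app W hW.weakEquivalence_map adj M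
    rw [adj.homEquiv_unit, ← weakEquivalence_restriction_map_iff W hW f]
    exact (weakEquivalence_precomp_iff (adj.unit.app M) ((restriction W).map f)).symm

end DwyerKan

end Presheaf

end

end EnrichedDK

theorem mainTheorem10 (V : Type u) [Category.{v} V] [MonoidalCategory V] [SymmetricCategory V]
    [MonoidalClosed V] [ModelCategory V] [EnrichedDK.MonoidalModelCategory V]
    [EnrichedDK.CombinatorialModelCategory V] [∀ X : V, IsCofibrant X]
    (A B : Type v) [EnrichedCategory V A] [EnrichedCategory V B]
    (W : EnrichedFunctor V A B) (hW : EnrichedDK.IsDwyerKanEquivalence W) :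
    ∃ (MA : ModelCategory (EnrichedDK.Presheaf V A)) (MB : ModelCategory (EnrichedDK.Presheaf V B)),
      EnrichedDK.IsProjective MA ∧ EnrichedDK.IsProjective MB ∧
      (EnrichedDK.restriction W).IsRightAdjoint ∧
      ∀ (L : EnrichedDK.Presheaf V A ⥤ EnrichedDK.Presheaf V B)
        (adj : L ⊣ EnrichedDK.restriction W),
        EnrichedDK.IsQuillenEquivalence adj := by
  have := EnrichedDK.CombinatorialModelCategory.isLocallyPresentable (V := V)
  exact ⟨EnrichedDK.Presheaf.projectiveModelCategory V A,
    EnrichedDK.Presheaf.projectiveModelCategory V B,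
    EnrichedDK.Presheaf.isProjective_projectiveModelCategory,
    EnrichedDK.Presheaf.isProjective_projectiveModelCategory,
    inferInstance, fun _ adj => EnrichedDK.Presheaf.isQuillenEquivalence_restriction W hW adj⟩
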